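/- Let $P$ be a finitary polynomial endofunctor over groupoids, represented by a diagram of groupoids $I \xleftarrow{s} E \xrightarrow{p} B \xrightarrow{t} I$ in which all homotopy fibres of $p$ are discrete and finite. A (finite rooted) tree is a diagram of finite sets $A \xleftarrow{s} M \xrightarrow{p} N \xrightarrow{t} A$ (edges $A$, nodes $N$) such that $t$ is injective, $s$ is injective with complement a single element, the root, and every edge reaches the root under iteration of the walk-to-the-root function $\sigma$, where $\sigma(\mathrm{root})=\mathrm{root}$ and $\sigma(s(m))=t(p(m))$ for $m\in M$. A leaf is an edge not in the image of $t$. A $P$-tree is a tree together with maps $A\to I$, $M\to E$, $N\to B$ and specified isomorphisms making the three squares to $I\leftarrow E\to B\to I$ commute, the middle square being a homotopy pullback; isomorphisms of $P$-trees are isomorphisms of trees together with compatible arrows between the decorations. A $P$-forest is a finite disjoint union of $P$-trees. A $P$-tree is dead if it has no leaves. Let $\mathscr{B}_P$ be the free commutative $\mathbb{Q}$-algebra on the set of isomorphism classes of $P$-trees (so that its monomials are the isomorphism classes of $P$-forests, the product being disjoint union). A cut of a $P$-tree $T$ is a subtree $S\subset T$ (containing all the incident edges of each of its nodes) which contains the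 root edge of $T$. For a cut $S$, let $P_S$ be the forest consisting, for each leaf $e$ of $S$, of the tree $D_e$ formed by $e$ and all the edges and nodes of $T$ above it. Let $\Delta:\mathscr{B}_P\to\mathscr{B}_P\otimes\mathscr{B}_P$ and $\varepsilon:\mathscr{B}_P\to\mathbb{Q}$ be the algebra homomorphisms given on a $P$-tree $T$ by $$\Delta(T)=\sum_{S\subset T \text{ cut}} P_S\otimes S ,\qquad \varepsilon(T)=\begin{cases}1 & \text{if } T \text{ has no nodes},\\ 0 & \text{otherwise.}\end{cases}$$ The node grading of $\mathscr{B}_P$ is the $\mathbb{N}$-grading in which a forest has as degree its number of nodes; the operadic grading is the $\mathbb{Z}$-grading in which a forest has as degree its number of leaves minus its number of roots. Proposition. With $\Delta$ and $\varepsilon$, $\mathscr{B}_P$ is a bialgebra, graded for both the node grading and the operadic grading. Let $\mathscr{D}\subset\mathscr{B}_P$ be the subalgebra generated by the dead $P$-trees. Then $\Delta$ restricts to an algebra homomorphism $\rho:\mathscr{D}\to\mathscr{D}\otimes\mathscr{B}_P$, and $\rho$ is a (coassociative and counital) right coaction, so that $\mathscr{D}$ is a right $\mathscr{B}_P$-comodule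 algebra and more precisely a right $\mathscr{B}_P$-coideal algebra. Moreover, for the node grading as well as for the operadic grading, $\mathscr{D}$ is a graded coideal algebra: with $\mathscr{D}_n=\mathscr{D}\cap(\mathscr{B}_P)_n$, the algebra $\mathscr{D}=\bigoplus_n\mathscr{D}_n$ is graded, and $\rho(\mathscr{D}_n)\subset\bigoplus_{i+j=n}\mathscr{D}_i\otimes(\mathscr{B}_P)_j$ for all $n$. -/

import Mathlib

open CategoryTheory
open scoped TensorProduct

universe v₁ v₂ v₃ u₁ u₂ u₃

/-- A finitary polynomial endofunctor over groupoids, given by its representing diagram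
`I ←s- E -p→ B -t→ I`, where all homotopy fibres of `p` are discrete (equivalent to a set) and
finite. The homotopy fibre of `p` over `b` is the groupoid of pairs `(e, p e ⟶ b)`, that is
`CostructuredArrow p b`. -/
structure FinitaryPolynomial (I : Type u₁) (E : Type u₂) (B : Type u₃)
    [Groupoid.{v₁} I] [Groupoid.{v₂} E] [Groupoid.{v₃} B] where
  s : E ⥤ I
  p : E ⥤ B
  t : B ⥤ I
  discrete_fibre : ∀ b : B, Quiver.IsThin (CostructuredArrow p b)
  finite_fibre : ∀ b : B, Finite (Quotient (isIsomorphicSetoid (CostructuredArrow p b)))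

/-- The walk-to-the-root function of a diagram `A ←s- M -p→ N -t→ A` with `s` injective: an edge
`s m` is sent to `t (p m)`, and an edge outside the image of `s` is sent to itself. -/
noncomputable def walkToRoot {A M N : Type} (s : M → A) (p : M → N) (t : N → A) (a : A) : A :=
  open Classical in if h : ∃ m, s m = a then t (p h.choose) else a

theorem walkToRoot_src {A M N : Type} {s : M → A} (hs : Function.Injective s) (p : M → N)
    (t : N → A) (m : M) : walkToRoot s p t (s m) = t (p m) := by
  have h : ∃ m', s m' = s m := ⟨m, rfl⟩
  rw [walkToRoot, dif_pos h, hs h.choose_spec]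

theorem walkToRoot_of_not {A M N : Type} {s : M → A} (p : M → N) (t : N → A) {a : A}
    (h : ¬ ∃ m, s m = a) : walkToRoot s p t a = a := by
  rw [walkToRoot, dif_neg h]

/-- A finite rooted operadic tree: a diagram of finite sets
`Edge ←src- Input -node→ Node -out→ Edge`, where `Input` is the set of nodes with a marked
incoming edge. -/
structure OperadicTree where
  Edge : Type
  Input : Type
  Node : Type
  [finite_edge : Finite Edge]
  [finite_input : Finite Input]
  [finite_node : Finite Node]
  src : Input → Edge
  node : Input → Node
  out : Node → Edge
  out_injective : Function.Injective out
  src_injective : Function.Injective src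
  root : Edge
  range_src : Set.range src = {root}ᶜ
  reach_root : ∀ a : Edge, ∃ k : ℕ, (walkToRoot src node out)^[k] a = root

attribute [instance] OperadicTree.finite_edge OperadicTree.finite_input OperadicTree.finite_node

namespace OperadicTree

variable (T : OperadicTree)

/-- The walk-to-the-root function on edges. -/
noncomputable def walk : T.Edge → T.Edge := walkToRoot T.src T.node T.out

variable {T}

theorem walk_src (m : T.Input) : T.walk (T.src m) = T.out (T.node m) :=
  walkToRoot_src T.src_injective _ _ m

theorem exists_src_iff (a : T.Edge) : (∃ m, T.src m = a) ↔ a ≠ T.root := by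
  have h := Set.ext_iff.1 T.range_src a
  simpa using h

theorem walk_root : T.walk T.root = T.root :=
  walkToRoot_of_not _ _ (fun h => (exists_src_iff _).1 h rfl)

theorem iterate_walk_root (k : ℕ) : T.walk^[k] T.root = T.root :=
  Function.iterate_fixed walk_root k

/-- An edge which is the output edge of no node. -/
def IsLeaf (a : T.Edge) : Prop := ∀ n : T.Node, T.out n ≠ a

variable (T)

/-- A subtree of `T`: subsets of edges and of nodes, such that the output edge and all the input
edges of each selected node are selected, and such that the selected edges and nodes, with
`node ⁻¹' nodes` as set of inputs, form a tree with root `root` (a selected edge is the root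
exactly when it is not an input edge of a selected node). -/
structure Subtree where
  edges : Set T.Edge
  nodes : Set T.Node
  root : T.Edge
  root_mem : root ∈ edges
  out_mem : ∀ n ∈ nodes, T.out n ∈ edges
  src_mem : ∀ m : T.Input, T.node m ∈ nodes → T.src m ∈ edges
  eq_root_iff : ∀ a ∈ edges, a = root ↔ ¬ ∃ m, T.node m ∈ nodes ∧ T.src m = a

variable {T}

namespace Subtree

@[ext] theorem ext' {S S' : T.Subtree} (he : S.edges = S'.edges) (hn : S.nodes = S'.nodes)
    (hr : S.root = S'.root) : S = S' := by
  cases S; cases S'; cases he; cases hn; cases hr; rfl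

instance : Finite T.Subtree :=
  Finite.of_injective (fun S : T.Subtree => (S.edges, S.nodes, S.root)) (by
    intro S S' h
    simp only [Prod.mk.injEq] at h
    exact ext' h.1 h.2.1 h.2.2)

variable (S : T.Subtree)

/-- A subtree is itself a tree, with the restricted structure maps. -/
def toTree : OperadicTree where
  Edge := S.edges
  Input := {m : T.Input // T.node m ∈ S.nodes}
  Node := S.nodes
  src m := ⟨T.src m.1, S.src_mem m.1 m.2⟩
  node m := ⟨T.node m.1, m.2⟩
  out n := ⟨T.out n.1, S.out_mem n.1 n.2⟩
  out_injective n n' h := Subtype.ext (T.out_injective (congrArg Subtype.val h))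
  src_injective m m' h := Subtype.ext (T.src_injective (congrArg Subtype.val h))
  root := ⟨S.root, S.root_mem⟩
  range_src := by
    ext ⟨a, ha⟩
    have h := S.eq_root_iff a ha
    simp only [Set.mem_range, Set.mem_compl_iff, Set.mem_singleton_iff, Subtype.mk.injEq, h,
      not_not, Subtype.exists, exists_prop]
  reach_root := by
    have key : ∀ (k : ℕ) (a : T.Edge) (ha : a ∈ S.edges), T.walk^[k] a = T.root →
        ∃ j : ℕ, (walkToRoot (A := S.edges) (M := {m : T.Input // T.node m ∈ S.nodes})
          (N := S.nodes) (fun m => ⟨T.src m.1, S.src_mem m.1 m.2⟩) (fun m => ⟨T.node m.1, m.2⟩)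
          (fun n => ⟨T.out n.1, S.out_mem n.1 n.2⟩))^[j] ⟨a, ha⟩ = ⟨S.root, S.root_mem⟩ := by
      intro k
      induction k with
      | zero =>
        intro a ha h
        refine ⟨0, Subtype.ext ?_⟩
        refine (S.eq_root_iff a ha).2 ?_
        rintro ⟨m, -, hm⟩
        exact (exists_src_iff a).1 ⟨m, hm⟩ h
      | succ k ih =>
        intro a ha h
        by_cases hr : a = S.root
        · exact ⟨0, Subtype.ext hr⟩
        · obtain ⟨m, hm, rfl⟩ : ∃ m, T.node m ∈ S.nodes ∧ T.src m = a := by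
            by_contra hc
            exact hr ((S.eq_root_iff a ha).2 hc)
          rw [Function.iterate_succ_apply, walk_src] at h
          obtain ⟨j, hj⟩ := ih _ (S.out_mem _ hm) h
          refine ⟨j + 1, ?_⟩
          rw [Function.iterate_succ_apply]
          have := walkToRoot_src (A := S.edges) (M := {m : T.Input // T.node m ∈ S.nodes})
            (N := S.nodes) (s := fun m => ⟨T.src m.1, S.src_mem m.1 m.2⟩)
            (fun m m' h => Subtype.ext (T.src_injective (congrArg Subtype.val h)))
            (fun m => ⟨T.node m.1, m.2⟩) (fun n => ⟨T.out n.1, S.out_mem n.1 n.2⟩) ⟨m, hm⟩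
          rw [this]
          exact hj
    rintro ⟨a, ha⟩
    obtain ⟨k, hk⟩ := T.reach_root a
    exact key k a ha hk

/-- The leaves of a subtree `S`, as edges of the ambient tree: the edges of `S` which are the
output edge of no node of `S`. -/
abbrev Leaf : Type := {a : T.Edge // a ∈ S.edges ∧ ∀ n ∈ S.nodes, T.out n ≠ a}

noncomputable instance : Fintype S.Leaf := Fintype.ofFinite _

end Subtree

variable (T)

/-- A cut of `T`: a subtree containing the root edge. -/
abbrev Cut : Type := {S : T.Subtree // T.root ∈ S.edges}

noncomputable instance : Fintype T.Cut := Fintype.ofFinite _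

variable {T}

/-- The ideal subtree `D_x` generated by an edge `x`: all the edges and nodes from which the walk
to the root passes through `x`. -/
def ideal (x : T.Edge) : T.Subtree where
  edges := {a | ∃ k : ℕ, T.walk^[k] a = x}
  nodes := {n | ∃ k : ℕ, T.walk^[k] (T.out n) = x}
  root := x
  root_mem := ⟨0, rfl⟩
  out_mem _ h := h
  src_mem := by
    rintro m ⟨k, hk⟩
    exact ⟨k + 1, by rw [Function.iterate_succ_apply, walk_src, hk]⟩
  eq_root_iff := by
    rintro a ⟨k, hk⟩
    constructor
    · rintro rfl ⟨m, ⟨j, hj⟩, rfl⟩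
      have hper : T.walk^[j + 1] (T.src m) = T.src m := by
        rw [Function.iterate_succ_apply, walk_src, hj]
      obtain ⟨l, hl⟩ := T.reach_root (T.src m)
      have h1 : T.walk^[(j + 1) * l] (T.src m) = T.src m := by
        rw [Function.iterate_mul]
        exact Function.iterate_fixed hper l
      have h2 : T.walk^[(j + 1) * l] (T.src m) = T.root := by
        have : (j + 1) * l = j * l + l := by ring
        rw [this, Function.iterate_add_apply]
        change T.walk^[j * l] ((walkToRoot T.src T.node T.out)^[l] (T.src m)) = T.root
        rw [hl, iterate_walk_root]
      exact (exists_src_iff _).1 ⟨m, rfl⟩ (h1.symm.trans h2)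
    · intro h
      cases k with
      | zero => exact hk
      | succ k =>
        by_cases har : a = T.root
        · subst har
          rw [iterate_walk_root] at hk
          exact hk
        · obtain ⟨m, rfl⟩ := (exists_src_iff a).2 har
          rw [Function.iterate_succ_apply, walk_src] at hk
          exact absurd ⟨m, ⟨k, hk⟩, rfl⟩ h

end OperadicTree

section PTrees

variable {I : Type u₁} {E : Type u₂} {B : Type u₃}
  [Groupoid.{v₁} I] [Groupoid.{v₂} E] [Groupoid.{v₃} B]

/-- The comparison functor from the discrete groupoid `M` to the homotopy pullback of
`E -p→ B ← N` (the comma groupoid) which is induced by a square from `M → N` to `p : E ⥤ B`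
commuting up to the specified isomorphisms `φ`. -/
def toHomotopyPullback (p : E ⥤ B) {M N : Type} (node : M → N) (decM : M → E) (decN : N → B)
    (φ : ∀ m, p.obj (decM m) ⟶ decN (node m)) :
    Discrete M ⥤ Comma p (Discrete.functor decN) :=
  Discrete.functor fun m =>
    { left := decM m
      right := ⟨node m⟩
      hom := φ m }

/-- A `P`-tree: a tree with a map to the diagram `I ← E → B → I`, consisting of decorations of
the edges in `I`, of the inputs in `E` and of the nodes in `B`, such that the three squares
commute up to specified isomorphisms and the middle one is a homotopy pullback. -/
structure PTree (P : FinitaryPolynomial I E B) extends OperadicTree where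
  edgeDec : Edge → I
  inputDec : Input → E
  nodeDec : Node → B
  srcHom : ∀ m, P.s.obj (inputDec m) ⟶ edgeDec (src m)
  nodeHom : ∀ m, P.p.obj (inputDec m) ⟶ nodeDec (node m)
  outHom : ∀ n, P.t.obj (nodeDec n) ⟶ edgeDec (out n)
  isPullback : (toHomotopyPullback P.p node inputDec nodeDec nodeHom).IsEquivalence

namespace PTree

variable {P : FinitaryPolynomial I E B}

/-- An isomorphism of `P`-trees: an isomorphism of the underlying trees, together with arrows
between the decorations of corresponding edges, inputs and nodes, compatible with the structure
isomorphisms of the three squares. (Correspondence is written as an equation `edge a = a'`, so that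
no transport along equalities is needed.) -/
structure Iso (T T' : PTree P) where
  edge : T.Edge ≃ T'.Edge
  input : T.Input ≃ T'.Input
  node : T.Node ≃ T'.Node
  src_comm : ∀ {m m'}, input m = m' → edge (T.src m) = T'.src m'
  node_comm : ∀ {m m'}, input m = m' → node (T.node m) = T'.node m'
  out_comm : ∀ {n n'}, node n = n' → edge (T.out n) = T'.out n'
  edgeArr : ∀ {a a'}, edge a = a' → (T.edgeDec a ⟶ T'.edgeDec a')
  inputArr : ∀ {m m'}, input m = m' → (T.inputDec m ⟶ T'.inputDec m')
  nodeArr : ∀ {n n'}, node n = n' → (T.nodeDec n ⟶ T'.nodeDec n')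
  src_sq : ∀ {m m'} (h : input m = m'),
    T.srcHom m ≫ edgeArr (src_comm h) = P.s.map (inputArr h) ≫ T'.srcHom m'
  node_sq : ∀ {m m'} (h : input m = m'),
    T.nodeHom m ≫ nodeArr (node_comm h) = P.p.map (inputArr h) ≫ T'.nodeHom m'
  out_sq : ∀ {n n'} (h : node n = n'),
    T.outHom n ≫ edgeArr (out_comm h) = P.t.map (nodeArr h) ≫ T'.outHom n'

namespace Iso

/-- The identity isomorphism. -/
def refl (T : PTree P) : Iso T T where
  edge := Equiv.refl _
  input := Equiv.refl _
  node := Equiv.refl _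
  src_comm h := by cases h; rfl
  node_comm h := by cases h; rfl
  out_comm h := by cases h; rfl
  edgeArr {a a'} h := eqToHom (congrArg T.edgeDec (show a = a' from h))
  inputArr {m m'} h := eqToHom (congrArg T.inputDec (show m = m' from h))
  nodeArr {n n'} h := eqToHom (congrArg T.nodeDec (show n = n' from h))
  src_sq h := by
    cases h
    exact (Category.comp_id _).trans
      ((congrArg (· ≫ _) (P.s.map_id _)).trans (Category.id_comp _)).symm
  node_sq h := by
    cases h
    exact (Category.comp_id _).trans
      ((congrArg (· ≫ _) (P.p.map_id _)).trans (Category.id_comp _)).symm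
  out_sq h := by
    cases h
    exact (Category.comp_id _).trans
      ((congrArg (· ≫ _) (P.t.map_id _)).trans (Category.id_comp _)).symm

/-- The inverse isomorphism. -/
def symm {T T' : PTree P} (f : Iso T T') : Iso T' T where
  edge := f.edge.symm
  input := f.input.symm
  node := f.node.symm
  src_comm h := f.edge.symm_apply_eq.2 (f.src_comm (f.input.symm_apply_eq.1 h).symm).symm
  node_comm h := f.node.symm_apply_eq.2 (f.node_comm (f.input.symm_apply_eq.1 h).symm).symm
  out_comm h := f.edge.symm_apply_eq.2 (f.out_comm (f.node.symm_apply_eq.1 h).symm).symm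
  edgeArr h := Groupoid.inv (f.edgeArr (f.edge.symm_apply_eq.1 h).symm)
  inputArr h := Groupoid.inv (f.inputArr (f.input.symm_apply_eq.1 h).symm)
  nodeArr h := Groupoid.inv (f.nodeArr (f.node.symm_apply_eq.1 h).symm)
  src_sq h := by
    have := f.src_sq (f.input.symm_apply_eq.1 h).symm
    rw [Groupoid.inv_eq_inv, Groupoid.inv_eq_inv, Functor.map_inv, IsIso.eq_inv_comp,
      ← Category.assoc, IsIso.comp_inv_eq]
    exact this.symm
  node_sq h := by
    have := f.node_sq (f.input.symm_apply_eq.1 h).symm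
    rw [Groupoid.inv_eq_inv, Groupoid.inv_eq_inv, Functor.map_inv, IsIso.eq_inv_comp,
      ← Category.assoc, IsIso.comp_inv_eq]
    exact this.symm
  out_sq h := by
    have := f.out_sq (f.node.symm_apply_eq.1 h).symm
    rw [Groupoid.inv_eq_inv, Groupoid.inv_eq_inv, Functor.map_inv, IsIso.eq_inv_comp,
      ← Category.assoc, IsIso.comp_inv_eq]
    exact this.symm

/-- Composition of isomorphisms. -/
def trans {T T' T'' : PTree P} (f : Iso T T') (g : Iso T' T'') : Iso T T'' where
  edge := f.edge.trans g.edge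
  input := f.input.trans g.input
  node := f.node.trans g.node
  src_comm h := (congrArg g.edge (f.src_comm rfl)).trans (g.src_comm h)
  node_comm h := (congrArg g.node (f.node_comm rfl)).trans (g.node_comm h)
  out_comm h := (congrArg g.edge (f.out_comm rfl)).trans (g.out_comm h)
  edgeArr h := f.edgeArr rfl ≫ g.edgeArr h
  inputArr h := f.inputArr rfl ≫ g.inputArr h
  nodeArr h := f.nodeArr rfl ≫ g.nodeArr h
  src_sq {m m''} h := by
    have key : ∀ {a b c} (h1 : f.edge a = b) (h2 : g.edge b = c),
        f.edgeArr (rfl : f.edge a = f.edge a) ≫ g.edgeArr ((congrArg g.edge h1).trans h2) =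
          f.edgeArr h1 ≫ g.edgeArr h2 := by
      intro a b c h1 h2; subst h1; rfl
    refine (congrArg (_ ≫ ·) (key (f.src_comm rfl) (g.src_comm h))).trans ?_
    rw [← Category.assoc, f.src_sq rfl, Category.assoc, g.src_sq h,
      Functor.map_comp, Category.assoc]
  node_sq {m m''} h := by
    have key : ∀ {a b c} (h1 : f.node a = b) (h2 : g.node b = c),
        f.nodeArr (rfl : f.node a = f.node a) ≫ g.nodeArr ((congrArg g.node h1).trans h2) =
          f.nodeArr h1 ≫ g.nodeArr h2 := by
      intro a b c h1 h2; subst h1; rfl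
    refine (congrArg (_ ≫ ·) (key (f.node_comm rfl) (g.node_comm h))).trans ?_
    rw [← Category.assoc, f.node_sq rfl, Category.assoc,
      g.node_sq h, Functor.map_comp, Category.assoc]
  out_sq {n n''} h := by
    have key : ∀ {a b c} (h1 : f.edge a = b) (h2 : g.edge b = c),
        f.edgeArr (rfl : f.edge a = f.edge a) ≫ g.edgeArr ((congrArg g.edge h1).trans h2) =
          f.edgeArr h1 ≫ g.edgeArr h2 := by
      intro a b c h1 h2; subst h1; rfl
    refine (congrArg (_ ≫ ·) (key (f.out_comm rfl) (g.out_comm h))).trans ?_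
    rw [← Category.assoc, f.out_sq rfl, Category.assoc, g.out_sq h,
      Functor.map_comp, Category.assoc]

end Iso

/-- Being isomorphic, as an equivalence relation on `P`-trees. -/
instance isoSetoid (P : FinitaryPolynomial I E B) : Setoid (PTree P) where
  r T T' := Nonempty (Iso T T')
  iseqv :=
    { refl := fun T => ⟨Iso.refl T⟩
      symm := fun ⟨f⟩ => ⟨f.symm⟩
      trans := fun ⟨f⟩ ⟨g⟩ => ⟨f.trans g⟩ }

/-- A square from a map of sets to `p`, with `p` having discrete homotopy fibres, is a homotopy
pullback exactly when each object of the homotopy pullback is isomorphic to the image of a unique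
element. -/
theorem isPullback_iff (P : FinitaryPolynomial I E B) {M N : Type} (node : M → N) (decM : M → E)
    (decN : N → B) (φ : ∀ m, P.p.obj (decM m) ⟶ decN (node m)) :
    (toHomotopyPullback P.p node decM decN φ).IsEquivalence ↔
      ∀ (n : N) (e : E) (ψ : P.p.obj e ⟶ decN n), ∃! m : M, ∃ (h : node m = n) (ε : decM m ⟶ e),
        φ m ≫ eqToHom (congrArg decN h) = P.p.map ε ≫ ψ := by
  have thin : ∀ (X Y : Comma P.p (Discrete.functor decN)) (f g : X ⟶ Y), f = g := by
    rintro ⟨e, ⟨n⟩, ψ⟩ ⟨e', ⟨n'⟩, ψ'⟩ f g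
    obtain ⟨fl, ⟨⟨fr⟩⟩, fw⟩ := f
    obtain ⟨gl, ⟨⟨gr⟩⟩, gw⟩ := g
    dsimp at fr gr fl gl
    subst fr
    have hf : P.p.map fl ≫ ψ' = ψ := fw.trans (Category.comp_id _)
    have hg : P.p.map gl ≫ ψ' = ψ := gw.trans (Category.comp_id _)
    have := (P.discrete_fibre (decN n) (CostructuredArrow.mk ψ) (CostructuredArrow.mk ψ')).elim
      (CostructuredArrow.homMk fl hf) (CostructuredArrow.homMk gl hg)
    have : fl = gl := congrArg CommaMorphism.left this
    subst this
    rfl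
  have hom_iff : ∀ (m : M) (n : N) (e : E) (ψ : P.p.obj e ⟶ decN n),
      Nonempty ((toHomotopyPullback P.p node decM decN φ).obj ⟨m⟩ ⟶
        ({ left := e, right := ⟨n⟩, hom := ψ } : Comma P.p (Discrete.functor decN))) ↔
      ∃ (h : node m = n) (ε : decM m ⟶ e),
        φ m ≫ eqToHom (congrArg decN h) = P.p.map ε ≫ ψ := by
    intro m n e ψ
    constructor
    · rintro ⟨⟨fl, ⟨⟨fr⟩⟩, fw⟩⟩
      have hr : node m = n := fr
      subst hr
      exact ⟨rfl, fl, fw.symm⟩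
    · rintro ⟨h, ε, hε⟩
      subst h
      exact ⟨⟨ε, 𝟙 _, hε.symm⟩⟩
  constructor
  · intro hF n e ψ
    let X : Comma P.p (Discrete.functor decN) := { left := e, right := ⟨n⟩, hom := ψ }
    refine ⟨((toHomotopyPullback P.p node decM decN φ).objPreimage X).as,
      (hom_iff _ _ _ _).1 ⟨((toHomotopyPullback P.p node decM decN φ).objObjPreimageIso X).hom⟩, ?_⟩
    intro m hm
    obtain ⟨g⟩ := (hom_iff _ _ _ _).2 hm
    exact Discrete.eq_of_hom ((toHomotopyPullback P.p node decM decN φ).preimage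
      (g ≫ ((toHomotopyPullback P.p node decM decN φ).objObjPreimageIso X).inv))
  · intro h
    have hiso : ∀ {X Y : Comma P.p (Discrete.functor decN)} (f : X ⟶ Y), Nonempty (X ≅ Y) := by
      intro X Y f
      exact ⟨Comma.isoMk (asIso f.left) (asIso f.right) f.w⟩
    refine { faithful := ⟨fun _ => Subsingleton.elim _ _⟩, full := ⟨?_⟩, essSurj := ⟨?_⟩ }
    · rintro ⟨m⟩ ⟨m'⟩ f
      have : m = m' := (h (node m') (decM m') (φ m')).unique
        ((hom_iff m _ _ _).1 ⟨f⟩) ((hom_iff m' _ _ _).1 ⟨𝟙 _⟩)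
      subst this
      exact ⟨𝟙 _, thin _ _ _ _⟩
    · rintro ⟨e, ⟨n⟩, ψ⟩
      obtain ⟨m, hm, -⟩ := h n e ψ
      obtain ⟨g⟩ := (hom_iff _ _ _ _).2 hm
      exact ⟨⟨m⟩, hiso g⟩

/-- The restriction of a `P`-tree to a subtree. -/
def restrict (T : PTree P) (S : T.Subtree) : PTree P where
  toOperadicTree := S.toTree
  edgeDec a := T.edgeDec a.1
  inputDec m := T.inputDec m.1
  nodeDec n := T.nodeDec n.1
  srcHom m := T.srcHom m.1
  nodeHom m := T.nodeHom m.1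
  outHom n := T.outHom n.1
  isPullback := by
    have h := (isPullback_iff P _ _ _ _).1 T.isPullback
    refine (isPullback_iff P _ _ _ _).2 ?_
    rintro ⟨n, hn⟩ e ψ
    obtain ⟨m, ⟨hm, ε, hε⟩, huniq⟩ := h n e ψ
    subst hm
    refine ⟨⟨m, hn⟩, ⟨rfl, ε, (Category.comp_id _).trans ((Category.comp_id _).symm.trans hε)⟩, ?_⟩
    rintro ⟨m', hm'⟩ ⟨h1, ε', hε'⟩
    exact Subtype.ext (huniq m' ⟨congrArg Subtype.val h1, ε', hε'⟩)

namespace Iso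

variable {T T' : PTree P} (f : Iso T T')

theorem edge_root : f.edge T.root = T'.root := by
  by_contra h
  obtain ⟨m', hm'⟩ := (OperadicTree.exists_src_iff _).2 h
  have := f.src_comm (f.input.apply_symm_apply m')
  exact (OperadicTree.exists_src_iff T.root).1
    ⟨f.input.symm m', f.edge.injective (this.trans hm')⟩ rfl

theorem edge_walk (a : T.Edge) : f.edge (T.walk a) = T'.walk (f.edge a) := by
  by_cases h : a = T.root
  · subst h
    rw [OperadicTree.walk_root, f.edge_root, OperadicTree.walk_root]
  · obtain ⟨m, rfl⟩ := (OperadicTree.exists_src_iff a).2 h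
    rw [OperadicTree.walk_src, f.src_comm rfl, OperadicTree.walk_src, ← f.node_comm rfl]
    exact f.out_comm rfl

theorem edge_iterate_walk (k : ℕ) (a : T.Edge) :
    f.edge (T.walk^[k] a) = T'.walk^[k] (f.edge a) := by
  induction k generalizing a with
  | zero => rfl
  | succ k ih => rw [Function.iterate_succ_apply, Function.iterate_succ_apply, ih, f.edge_walk]

/-- The image of a subtree under an isomorphism. -/
def mapSubtree (S : T.Subtree) : T'.Subtree where
  edges := {a | f.edge.symm a ∈ S.edges}
  nodes := {n | f.node.symm n ∈ S.nodes}
  root := f.edge S.root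
  root_mem := by simpa using S.root_mem
  out_mem n hn := by
    have h : f.edge.symm (T'.out n) = T.out (f.node.symm n) := f.symm.out_comm rfl
    simpa [h] using S.out_mem _ hn
  src_mem m hm := by
    have h1 : f.edge.symm (T'.src m) = T.src (f.input.symm m) := f.symm.src_comm rfl
    have h2 : f.node.symm (T'.node m) = T.node (f.input.symm m) := f.symm.node_comm rfl
    simp only [Set.mem_ofPred_eq, h2] at hm
    simpa [h1] using S.src_mem _ hm
  eq_root_iff a ha := by
    rw [← f.edge.symm_apply_eq, S.eq_root_iff _ ha, not_iff_not, ← f.input.symm.exists_congr_right]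
    refine exists_congr fun m => ?_
    have h1 : f.edge.symm (T'.src m) = T.src (f.input.symm m) := f.symm.src_comm rfl
    have h2 : f.node.symm (T'.node m) = T.node (f.input.symm m) := f.symm.node_comm rfl
    rw [Set.mem_ofPred_eq, h2, ← h1, f.edge.symm.injective.eq_iff]

/-- The bijection on subtrees induced by an isomorphism. -/
def subtreeEquiv : T.Subtree ≃ T'.Subtree where
  toFun := f.mapSubtree
  invFun := f.symm.mapSubtree
  left_inv S := by ext <;> simp [mapSubtree, symm]
  right_inv S := by ext <;> simp [mapSubtree, symm]

/-- The bijection on cuts induced by an isomorphism. -/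
def cutEquiv : T.Cut ≃ T'.Cut :=
  f.subtreeEquiv.subtypeEquiv fun S => by
    have : f.edge.symm T'.root = T.root := f.symm.edge_root
    simp [subtreeEquiv, mapSubtree, this]

theorem mapSubtree_ideal (x : T.Edge) :
    f.mapSubtree (OperadicTree.ideal x) = OperadicTree.ideal (f.edge x) := by
  ext a
  · refine exists_congr fun k => ?_
    have := f.edge_iterate_walk k (f.edge.symm a)
    rw [f.edge.apply_symm_apply] at this
    rw [← this, f.edge.injective.eq_iff]
  · refine exists_congr fun k => ?_
    have h : f.edge.symm (T'.out a) = T.out (f.node.symm a) := f.symm.out_comm rfl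
    have := f.edge_iterate_walk k (T.out (f.node.symm a))
    rw [← h, f.edge.apply_symm_apply] at this
    rw [← this, f.edge.injective.eq_iff, h]
  · rfl

/-- The isomorphism between a subtree and its image. -/
def restrict (S : T.Subtree) : Iso (T.restrict S) (T'.restrict (f.mapSubtree S)) where
  edge := f.edge.subtypeEquiv fun a => by simp [mapSubtree]
  input := f.input.subtypeEquiv fun m => by
    have h : f.node (T.node m) = T'.node (f.input m) := f.node_comm rfl
    simp [mapSubtree, ← h]
  node := f.node.subtypeEquiv fun n => by simp [mapSubtree]
  src_comm h := Subtype.ext (f.src_comm (congrArg Subtype.val h))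
  node_comm h := Subtype.ext (f.node_comm (congrArg Subtype.val h))
  out_comm h := Subtype.ext (f.out_comm (congrArg Subtype.val h))
  edgeArr h := f.edgeArr (congrArg Subtype.val h)
  inputArr h := f.inputArr (congrArg Subtype.val h)
  nodeArr h := f.nodeArr (congrArg Subtype.val h)
  src_sq h := f.src_sq (congrArg Subtype.val h)
  node_sq h := f.node_sq (congrArg Subtype.val h)
  out_sq h := f.out_sq (congrArg Subtype.val h)

/-- The bijection between the leaves of a subtree and those of its image. -/
def leafEquiv (S : T.Subtree) : S.Leaf ≃ (f.mapSubtree S).Leaf :=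
  f.edge.subtypeEquiv fun a => by
    refine and_congr (by simp [mapSubtree]) ?_
    rw [← f.node.forall_congr_right]
    refine forall_congr' fun n => ?_
    have h : f.edge (T.out n) = T'.out (f.node n) := f.out_comm rfl
    rw [← h, ne_eq, ne_eq, f.edge.injective.eq_iff]
    simp [mapSubtree]

theorem isLeaf_iff (a : T.Edge) : T.IsLeaf a ↔ T'.IsLeaf (f.edge a) := by
  unfold OperadicTree.IsLeaf
  rw [← f.node.forall_congr_right]
  refine forall_congr' fun n => ?_
  have h : f.edge (T.out n) = T'.out (f.node n) := f.out_comm rfl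
  rw [← h, ne_eq, ne_eq, f.edge.injective.eq_iff]

end Iso

/-- The set of isomorphism classes of `P`-trees. -/
def Class (P : FinitaryPolynomial I E B) := Quotient (isoSetoid P)

/-- The isomorphism class of a `P`-tree. -/
def cls (T : PTree P) : Class P := Quotient.mk _ T

theorem Iso.cls_eq {T T' : PTree P} (f : Iso T T') : cls T = cls T' := Quotient.sound ⟨f⟩

/-- The number of nodes of (an isomorphism class of) a `P`-tree. -/
noncomputable def nodeCount : Class P → ℕ :=
  Quotient.lift (fun T : PTree P => Nat.card T.Node) fun _ _ ⟨f⟩ => Nat.card_congr f.node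

/-- The number of leaves of (an isomorphism class of) a `P`-tree. -/
noncomputable def leafCount : Class P → ℕ :=
  Quotient.lift (fun T : PTree P => Nat.card {a // T.IsLeaf a}) fun _ _ ⟨f⟩ =>
    Nat.card_congr (f.edge.subtypeEquiv f.isLeaf_iff)

/-- A dead `P`-tree: a `P`-tree without leaves. -/
def IsDead (T : PTree P) : Prop := ∀ a : T.Edge, ¬ T.IsLeaf a

end PTree

/-- The algebra `B_P`: the free commutative `ℚ`-algebra on the isomorphism classes of `P`-trees.
Its monomials are the isomorphism classes of `P`-forests, the product being disjoint union. -/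
abbrev TreeAlgebra (P : FinitaryPolynomial I E B) := MvPolynomial (PTree.Class P) ℚ

namespace TreeAlgebra

open PTree

variable {P : FinitaryPolynomial I E B}

/-- The generator of `B_P` given by a `P`-tree. -/
noncomputable def gen (T : PTree P) : TreeAlgebra P := MvPolynomial.X (cls T)

/-- The forest of all the ideal subtrees generated by the leaves of a subtree `S`. -/
noncomputable def crown (T : PTree P) (S : T.Subtree) : TreeAlgebra P :=
  ∏ e : S.Leaf, gen (T.restrict (OperadicTree.ideal e.1))

theorem gen_congr {T T' : PTree P} (f : Iso T T') : gen T = gen T' :=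
  congrArg MvPolynomial.X f.cls_eq

theorem crown_congr {T T' : PTree P} (f : Iso T T') (S : T.Subtree) :
    crown T S = crown T' (f.mapSubtree S) := by
  refine Fintype.prod_equiv (f.leafEquiv S) _ _ fun e => ?_
  rw [gen_congr (f.restrict (OperadicTree.ideal e.1)), f.mapSubtree_ideal]
  rfl

/-- The comultiplication of a single `P`-tree `T`: the sum over all cuts `S` of `T` of the crown
forest tensor the bottom tree `S`. -/
noncomputable def comulTree (T : PTree P) : TreeAlgebra P ⊗[ℚ] TreeAlgebra P :=
  ∑ c : T.Cut, crown T c.1 ⊗ₜ[ℚ] gen (T.restrict c.1)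

theorem comulTree_congr {T T' : PTree P} (f : Iso T T') : comulTree T = comulTree T' := by
  refine Fintype.sum_equiv f.cutEquiv _ _ fun c => ?_
  rw [crown_congr f c.1, gen_congr (f.restrict c.1)]
  rfl

/-- The comultiplication of `B_P`: the algebra homomorphism extending `comulTree`. -/
noncomputable def comul (P : FinitaryPolynomial I E B) :
    TreeAlgebra P →ₐ[ℚ] TreeAlgebra P ⊗[ℚ] TreeAlgebra P :=
  MvPolynomial.aeval (Quotient.lift comulTree fun _ _ ⟨f⟩ => comulTree_congr f)

/-- The counit of `B_P`: the algebra homomorphism sending nodeless trees to `1` and all other trees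
to `0`. -/
noncomputable def counit (P : FinitaryPolynomial I E B) : TreeAlgebra P →ₐ[ℚ] ℚ :=
  MvPolynomial.aeval fun x : Class P => if nodeCount x = 0 then 1 else 0

/-- The node grading of `B_P`: degree `n` is spanned by the forests with `n` nodes. -/
noncomputable def nodeGrading (P : FinitaryPolynomial I E B) (n : ℕ) :
    Submodule ℚ (TreeAlgebra P) :=
  MvPolynomial.weightedHomogeneousSubmodule ℚ (fun x : Class P => nodeCount x) n

/-- The operadic grading of `B_P`: degree `n` is spanned by the forests for which the number of
leaves minus the number of roots is `n`. -/
noncomputable def operadicGrading (P : FinitaryPolynomial I E B) (n : ℤ) :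
    Submodule ℚ (TreeAlgebra P) :=
  MvPolynomial.weightedHomogeneousSubmodule ℚ (fun x : Class P => (leafCount x : ℤ) - 1) n

/-- The subalgebra of `B_P` generated by the dead `P`-trees (so spanned by the forests of dead
`P`-trees). -/
noncomputable def dead (P : FinitaryPolynomial I E B) : Subalgebra ℚ (TreeAlgebra P) :=
  Algebra.adjoin ℚ {x | ∃ T : PTree P, T.IsDead ∧ gen T = x}

end TreeAlgebra

end PTrees

section Coalgebra

variable {R H M : Type*} [CommRing R] [CommRing H] [Algebra R H] [CommRing M] [Algebra R M]

/-- The algebra homomorphisms `Δ` and `ε` make the algebra `H` a bialgebra. -/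
structure IsBialgebra (Δ : H →ₐ[R] H ⊗[R] H) (ε : H →ₐ[R] R) : Prop where
  coassoc : (Algebra.TensorProduct.assoc R R R H H H).toAlgHom.comp
    ((Algebra.TensorProduct.map Δ (.id R H)).comp Δ) =
      (Algebra.TensorProduct.map (.id R H) Δ).comp Δ
  counit_left : (Algebra.TensorProduct.map ε (.id R H)).comp Δ =
    (Algebra.TensorProduct.lid R H).symm
  counit_right : (Algebra.TensorProduct.map (.id R H) ε).comp Δ =
    (Algebra.TensorProduct.rid R R H).symm

/-- The algebra homomorphism `ρ : M → M ⊗ H` makes the algebra `M` a right comodule algebra over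
the bialgebra `H` with comultiplication `Δ` and counit `ε`. -/
structure IsRightComoduleAlgebra (Δ : H →ₐ[R] H ⊗[R] H) (ε : H →ₐ[R] R)
    (ρ : M →ₐ[R] M ⊗[R] H) : Prop where
  coassoc : (Algebra.TensorProduct.assoc R R R M H H).toAlgHom.comp
    ((Algebra.TensorProduct.map ρ (.id R H)).comp ρ) =
      (Algebra.TensorProduct.map (.id R M) Δ).comp ρ
  counit : (Algebra.TensorProduct.map (.id R M) ε).comp ρ = (Algebra.TensorProduct.rid R R M).symm

/-- The subalgebra `D` of the bialgebra `H` is a right coideal algebra with coaction `ρ`: the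
comultiplication of `H` restricts to `ρ : D → D ⊗ H`, which makes `D` a right comodule algebra. -/
structure IsRightCoidealAlgebra (Δ : H →ₐ[R] H ⊗[R] H) (ε : H →ₐ[R] R) (D : Subalgebra R H)
    (ρ : D →ₐ[R] D ⊗[R] H) : Prop extends IsRightComoduleAlgebra Δ ε ρ where
  restrict : (Algebra.TensorProduct.map D.val (.id R H)).comp ρ = Δ.comp D.val

variable {ι : Type*} [DecidableEq ι] [AddMonoid ι]

/-- The degree `n` part `⨁_{i + j = n} 𝒜 i ⊗ ℬ j` of a tensor product of graded modules. -/
def tensorGrading (𝒜 : ι → Submodule R M) (ℬ : ι → Submodule R H) (n : ι) :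
    Submodule R (M ⊗[R] H) :=
  ⨆ ij : {ij : ι × ι // ij.1 + ij.2 = n},
    LinearMap.range (TensorProduct.map (𝒜 ij.1.1).subtype (ℬ ij.1.2).subtype)

/-- The submodules `ℬ n` form a grading of the bialgebra `H`: they are an algebra grading, and the
comultiplication and the counit preserve degrees. -/
structure IsBialgebraGrading (Δ : H →ₐ[R] H ⊗[R] H) (ε : H →ₐ[R] R) (ℬ : ι → Submodule R H) :
    Prop where
  graded : Nonempty (GradedAlgebra ℬ)
  comul_mem : ∀ n, ∀ x ∈ ℬ n, Δ x ∈ tensorGrading ℬ ℬ n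
  counit_eq_zero : ∀ n, n ≠ 0 → ∀ x ∈ ℬ n, ε x = 0

/-- The submodules `𝒟 n` form a grading of the right comodule algebra `M` over the graded bialgebra
`H`: they are an algebra grading, and the coaction preserves degrees. -/
structure IsComoduleAlgebraGrading (ρ : M →ₐ[R] M ⊗[R] H) (ℬ : ι → Submodule R H)
    (𝒟 : ι → Submodule R M) : Prop where
  graded : Nonempty (GradedAlgebra 𝒟)
  coaction_mem : ∀ n, ∀ x ∈ 𝒟 n, ρ x ∈ tensorGrading 𝒟 ℬ n

/-- The family of submodules of a subalgebra `D` obtained by intersecting `D` with a family of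
submodules of `H`. -/
def inducedGrading (ℬ : ι → Submodule R H) (D : Subalgebra R H) (n : ι) : Submodule R D :=
  (ℬ n).comap D.val.toLinearMap

end Coalgebra

/-! ### The tree order on edges. -/

namespace OperadicTree

variable {T : OperadicTree}

/-! Coassociativity is a double count of nested subtrees `c ⊂ c'` of `T` sharing the root of `T`. In
`(Δ ⊗ id)Δ(T)` one picks `c` and then a cut of `D_e` for every leaf `e` of `c`; gluing these cuts
onto `c` gives `c'` (`extensionEquiv`, `comul_crown`). In `(id ⊗ Δ)Δ(T)` one picks `c'` and then a
cut `c` of it (`cutToTreeEquiv`, `comulTree_restrict`). Either way the summand is the crown of `c'`,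
tensor the forest of parts of `c'` above the leaves of `c`, tensor `c`, so `nestedEquiv` matches the
sums. Since all pieces are subtrees of one fixed `T`, and a subtree is determined by its root and
nodes, isomorphism classes hardly enter. The counit laws hold because just one cut survives: the
whole tree on one side, the bare root edge on the other.

Both gradings come from a weight of trees that is additive along cuts. A cut partitions the nodes of
`T`, and the leaves of `T` are those of the `D_e`; in leaves minus roots, the leaves of `c` cancel
the roots of the `D_e`. Multiplicativity extends homogeneity from single trees to all forests.

A leaf of `D_e` is a leaf of `T`, so the crown of a dead tree is a forest of dead trees, and `Δ`
restricts to `ρ` on the dead subalgebra (`map_comp_coact`). The coaction laws are those of `Δ`,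
reflected along the inclusion of the subalgebra tensored with a flat module. The induced grading
exists because the generators are homogeneous. -/

theorem eq_root_of_iterate_walk_eq_self {a : T.Edge} {k : ℕ} (hk : k ≠ 0)
    (h : T.walk^[k] a = a) : a = T.root := by
  obtain ⟨l, hl⟩ : ∃ l, T.walk^[l] a = T.root := T.reach_root a
  have h1 : T.walk^[k * l] a = a := by
    rw [Function.iterate_mul]
    exact Function.iterate_fixed h l
  have h2 : k * l = (k - 1) * l + l := by
    obtain ⟨k, rfl⟩ := Nat.exists_eq_succ_of_ne_zero hk
    simp [Nat.succ_mul]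
  rw [← h1, h2, Function.iterate_add_apply, hl, iterate_walk_root]

theorem mem_ideal_trans {a b c : T.Edge} (hab : a ∈ (ideal b).edges) (hbc : b ∈ (ideal c).edges) :
    a ∈ (ideal c).edges := by
  obtain ⟨k, rfl⟩ := hab
  obtain ⟨j, rfl⟩ := hbc
  exact ⟨j + k, by rw [Function.iterate_add_apply]⟩

/-- Two distinct edges above each other would form a cycle of the walk, and the only cycle is the
fixed root. -/
theorem mem_ideal_antisymm {a b : T.Edge} (hab : a ∈ (ideal b).edges)
    (hba : b ∈ (ideal a).edges) : a = b := by
  obtain ⟨k, rfl⟩ := hab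
  obtain ⟨j, hj⟩ := hba
  rw [← Function.iterate_add_apply] at hj
  by_cases h : j + k = 0
  · obtain rfl : k = 0 := by omega
    rfl
  · rw [eq_root_of_iterate_walk_eq_self h hj, iterate_walk_root]

/-- Both edges lie on the unique path from `a` to the root. -/
theorem mem_ideal_total {a x y : T.Edge} (hx : a ∈ (ideal x).edges) (hy : a ∈ (ideal y).edges) :
    x ∈ (ideal y).edges ∨ y ∈ (ideal x).edges := by
  obtain ⟨k, rfl⟩ := hx
  obtain ⟨j, rfl⟩ := hy
  rcases le_total k j with h | h
  · refine Or.inl ⟨j - k, ?_⟩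
    rw [← Function.iterate_add_apply, Nat.sub_add_cancel h]
  · refine Or.inr ⟨k - j, ?_⟩
    rw [← Function.iterate_add_apply, Nat.sub_add_cancel h]

theorem src_mem_ideal {m : T.Input} {x : T.Edge} (h : T.out (T.node m) ∈ (ideal x).edges) :
    T.src m ∈ (ideal x).edges :=
  (ideal x).src_mem m h

theorem mem_ideal_root (a : T.Edge) : a ∈ (ideal T.root).edges := T.reach_root a

/-! ### Subtrees, their leaves, gluing, and subtrees of subtrees. -/

namespace Subtree

theorem mem_edges_iff (S : T.Subtree) {a : T.Edge} :
    a ∈ S.edges ↔ a = S.root ∨ ∃ m, T.node m ∈ S.nodes ∧ T.src m = a := by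
  constructor
  · intro h
    by_cases hr : a = S.root
    · exact Or.inl hr
    · exact Or.inr (not_not.1 fun hc => hr ((S.eq_root_iff a h).2 hc))
  · rintro (rfl | ⟨m, hm, rfl⟩)
    · exact S.root_mem
    · exact S.src_mem m hm

/-- The edges are forced: the root and the inputs of the selected nodes. Later equalities of
subtrees reduce to node sets this way. -/
theorem ext_nodes {S S' : T.Subtree} (hr : S.root = S'.root) (hn : S.nodes = S'.nodes) :
    S = S' := by
  refine ext' ?_ hn hr
  ext a
  rw [S.mem_edges_iff, S'.mem_edges_iff, hr, hn]

theorem edges_subset {S S' : T.Subtree} (hr : S.root ∈ S'.edges) (hn : S.nodes ⊆ S'.nodes) :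
    S.edges ⊆ S'.edges := by
  intro a ha
  rcases S.mem_edges_iff.1 ha with rfl | ⟨m, hm, rfl⟩
  · exact hr
  · exact S'.src_mem m (hn hm)

/-- Walking down from an edge of `S` stays in `S` until its root is met; the induction is on the
distance to the root of `T`. -/
theorem mem_ideal_of_mem (S : T.Subtree) {a : T.Edge} (ha : a ∈ S.edges) :
    a ∈ (ideal S.root).edges := by
  obtain ⟨k, hk⟩ : ∃ k, T.walk^[k] a = T.root := T.reach_root a
  induction k generalizing a with
  | zero =>
    rcases S.mem_edges_iff.1 ha with rfl | ⟨m, hm, rfl⟩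
    · exact (ideal S.root).root_mem
    · exact absurd hk ((exists_src_iff _).1 ⟨m, rfl⟩)
  | succ k ih =>
    rcases S.mem_edges_iff.1 ha with rfl | ⟨m, hm, rfl⟩
    · exact (ideal S.root).root_mem
    · rw [Function.iterate_succ_apply, walk_src] at hk
      exact src_mem_ideal (ih (S.out_mem _ hm) hk)

theorem nodes_subset_ideal (S : T.Subtree) : S.nodes ⊆ (ideal S.root).nodes :=
  fun _ hn => S.mem_ideal_of_mem (S.out_mem _ hn)

theorem mem_of_root_eq (S : T.Subtree) {x : T.Edge} (h : S.root = x) : x ∈ S.edges :=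
  h ▸ S.root_mem

theorem nodes_subset_ideal_of_root_eq (S : T.Subtree) {x : T.Edge} (h : S.root = x) :
    S.nodes ⊆ (ideal x).nodes :=
  h ▸ S.nodes_subset_ideal

theorem root_eq_of_mem (S : T.Subtree) (h : T.root ∈ S.edges) : S.root = T.root :=
  ((S.eq_root_iff _ h).2 fun ⟨m, _, hm⟩ => (exists_src_iff _).1 ⟨m, hm⟩ rfl).symm

theorem root_mem_iff (S : T.Subtree) : T.root ∈ S.edges ↔ S.root = T.root :=
  ⟨S.root_eq_of_mem, fun h => h ▸ S.root_mem⟩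

/-- Nothing of `S` lies strictly above a leaf: a walk inside `S` could enter `e` only through a node
of `S` with output `e`. -/
theorem eq_of_mem_ideal_leaf (S : T.Subtree) (e : S.Leaf) {a : T.Edge} (ha : a ∈ S.edges)
    (h : a ∈ (ideal e.1).edges) : a = e.1 := by
  obtain ⟨k, hk⟩ := h
  induction k generalizing a with
  | zero => exact hk
  | succ k ih =>
    rcases S.mem_edges_iff.1 ha with rfl | ⟨m, hm, rfl⟩
    · exact mem_ideal_antisymm ⟨k + 1, hk⟩ (S.mem_ideal_of_mem e.2.1)
    · rw [Function.iterate_succ_apply, walk_src] at hk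
      exact absurd (ih (S.out_mem _ hm) hk) (e.2.2 _ hm)

/-- Two leaves below a common edge are comparable, hence equal by maximality. So the `D_e` are
pairwise disjoint. -/
theorem leaf_unique (S : T.Subtree) {e e' : S.Leaf} {a : T.Edge} (h : a ∈ (ideal e.1).edges)
    (h' : a ∈ (ideal e'.1).edges) : e = e' := by
  rcases mem_ideal_total h h' with h1 | h1
  · exact Subtype.ext (S.eq_of_mem_ideal_leaf e' e.2.1 h1)
  · exact Subtype.ext (S.eq_of_mem_ideal_leaf e e'.2.1 h1).symm

theorem notMem_ideal_leaf (S : T.Subtree) (e : S.Leaf) {n : T.Node} (hn : n ∈ S.nodes) :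
    n ∉ (ideal e.1).nodes := fun h =>
  e.2.2 n hn (S.eq_of_mem_ideal_leaf e (S.out_mem n hn) h)

theorem exists_leaf_of_mem (S : T.Subtree) {a : T.Edge} (ha : a ∈ S.edges) :
    (∃ n ∈ S.nodes, T.out n = a) ∨ ∃ e : S.Leaf, a ∈ (ideal e.1).edges := by
  by_cases h : ∃ n ∈ S.nodes, T.out n = a
  · exact Or.inl h
  · push Not at h
    exact Or.inr ⟨⟨a, ha, h⟩, (ideal a).root_mem⟩

/-- Induction on the distance to the root of `S`: an input of a node of `S` is again an edge of `S`,
and lying above a leaf passes upwards. -/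
theorem exists_leaf (S : T.Subtree) {a : T.Edge} (ha : a ∈ (ideal S.root).edges) :
    (∃ n ∈ S.nodes, T.out n = a) ∨ ∃ e : S.Leaf, a ∈ (ideal e.1).edges := by
  obtain ⟨k, hk⟩ := ha
  induction k generalizing a with
  | zero =>
    obtain rfl : a = S.root := hk
    exact S.exists_leaf_of_mem S.root_mem
  | succ k ih =>
    -- The walk fixes the root of `T`, so in this case it is also the root of `S`.
    by_cases har : a = T.root
    · subst har
      rw [iterate_walk_root] at hk
      exact S.exists_leaf_of_mem (hk ▸ S.root_mem)
    · obtain ⟨m, rfl⟩ := (exists_src_iff a).2 har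
      rw [Function.iterate_succ_apply, walk_src] at hk
      rcases ih hk with ⟨n, hn, hnm⟩ | ⟨e, he⟩
      · rw [T.out_injective hnm] at hn
        exact S.exists_leaf_of_mem (S.src_mem m hn)
      · exact Or.inr ⟨e, src_mem_ideal he⟩

theorem mem_nodes_or_exists_leaf (S : T.Subtree) {n : T.Node} (hn : n ∈ (ideal S.root).nodes) :
    n ∈ S.nodes ∨ ∃ e : S.Leaf, n ∈ (ideal e.1).nodes := by
  rcases S.exists_leaf (a := T.out n) hn with ⟨n', hn', h⟩ | h
  · exact Or.inl (T.out_injective h ▸ hn')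
  · exact Or.inr h

/-- The part of a subtree `S` above one of its edges `x`. -/
def above (S : T.Subtree) (x : T.Edge) (hx : x ∈ S.edges) : T.Subtree where
  edges := (ideal x).edges ∩ S.edges
  nodes := (ideal x).nodes ∩ S.nodes
  root := x
  root_mem := ⟨(ideal x).root_mem, hx⟩
  out_mem n hn := ⟨hn.1, S.out_mem n hn.2⟩
  src_mem m hm := ⟨(ideal x).src_mem m hm.1, S.src_mem m hm.2⟩
  eq_root_iff := by
    rintro a ⟨ha, haS⟩
    constructor
    · rintro rfl ⟨m, hm, hma⟩
      exact ((ideal a).eq_root_iff a ha).1 rfl ⟨m, hm.1, hma⟩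
    · intro h
      rcases S.mem_edges_iff.1 haS with rfl | ⟨m, hm, rfl⟩
      · exact mem_ideal_antisymm ha (S.mem_ideal_of_mem hx)
      · rcases (ideal x).mem_edges_iff.1 ha with h1 | ⟨m', hm', h1⟩
        · exact h1
        · rw [T.src_injective h1] at hm'
          exact absurd ⟨m, ⟨hm', hm⟩, rfl⟩ h

theorem above_ideal {x y : T.Edge} (hy : y ∈ (ideal x).edges) :
    (ideal x).above y hy = ideal y :=
  ext_nodes rfl (Set.inter_eq_left.2 fun _ hn => mem_ideal_trans hn hy)

/-- The subtree obtained from a subtree `c` by grafting onto each leaf `e` of `c` a subtree with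
root `e`. -/
def glue (c : T.Subtree) (d : ∀ e : c.Leaf, {d : T.Subtree // d.root = e.1}) : T.Subtree where
  edges := {a | a ∈ c.edges ∨ ∃ e, a ∈ (d e).1.edges}
  nodes := {n | n ∈ c.nodes ∨ ∃ e, n ∈ (d e).1.nodes}
  root := c.root
  root_mem := Or.inl c.root_mem
  out_mem n hn := hn.imp (c.out_mem n) fun ⟨e, he⟩ => ⟨e, (d e).1.out_mem n he⟩
  src_mem m hm := hm.imp (c.src_mem m) fun ⟨e, he⟩ => ⟨e, (d e).1.src_mem m he⟩
  eq_root_iff := by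
    have hc : ∀ a ∈ c.edges,
        (¬ ∃ m, (T.node m ∈ c.nodes ∨ ∃ e, T.node m ∈ (d e).1.nodes) ∧ T.src m = a) →
        a = c.root :=
      fun a ha h => (c.eq_root_iff a ha).2 fun ⟨m, hm, hma⟩ => h ⟨m, Or.inl hm, hma⟩
    intro a ha
    constructor
    · rintro rfl ⟨m, hm | ⟨e, hm⟩, hma⟩
      · exact (c.eq_root_iff _ c.root_mem).1 rfl ⟨m, hm, hma⟩
      -- The root of `c` would lie above the leaf `e`, hence equal `e`, the root of `d e`; but it is
      -- an input of a node of `d e`.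
      · have h1 := (d e).1.src_mem m hm
        have h2 := (d e).1.mem_ideal_of_mem h1
        rw [(d e).2, hma] at h2
        have h3 := c.eq_of_mem_ideal_leaf e c.root_mem h2
        refine ((d e).1.eq_root_iff _ h1).1 ?_ ⟨m, hm, rfl⟩
        rw [hma, h3, (d e).2]
    · intro h
      rcases ha with ha | ⟨e, ha⟩
      · exact hc a ha h
      -- An edge of `d e` that is no input of its nodes is its root `e`, which already belongs to
      -- `c`.
      · refine hc a ?_ h
        have : a = (d e).1.root := ((d e).1.eq_root_iff a ha).2 fun ⟨m, hm, hma⟩ =>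
          h ⟨m, Or.inr ⟨e, hm⟩, hma⟩
        rw [this, (d e).2]
        exact e.2.1

/-- The subtrees containing a given subtree `c` and having the same root. -/
abbrev Extension (c : T.Subtree) : Type :=
  {c' : T.Subtree // c.nodes ⊆ c'.nodes ∧ c.root = c'.root}

noncomputable instance (c : T.Subtree) : Fintype c.Extension := Fintype.ofFinite _

/-- The subtrees contained in a given subtree `S` and having the same root. -/
abbrev Restriction (S : T.Subtree) : Type :=
  {c : T.Subtree // c.nodes ⊆ S.nodes ∧ c.root = S.root}

noncomputable instance (S : T.Subtree) : Fintype S.Restriction := Fintype.ofFinite _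

/-- The subtrees with a given root. -/
abbrev RootedAt (x : T.Edge) : Type := {d : T.Subtree // d.root = x}

noncomputable instance (x : T.Edge) : Fintype (RootedAt x) := Fintype.ofFinite _

theorem Extension.edges_subset {c : T.Subtree} (c' : c.Extension) : c.edges ⊆ c'.1.edges :=
  Subtree.edges_subset (c'.1.mem_of_root_eq c'.2.2.symm) c'.2.1

theorem Restriction.edges_subset {S : T.Subtree} (c : S.Restriction) : c.1.edges ⊆ S.edges :=
  Subtree.edges_subset (S.mem_of_root_eq c.2.2.symm) c.2.1

theorem Extension.nodes_subset_ideal {c : T.Subtree} (c' : c.Extension) :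
    c'.1.nodes ⊆ (ideal c.root).nodes := 
  c'.1.nodes_subset_ideal_of_root_eq c'.2.2.symm

/-- The part of an extension of `c` which lies above a leaf of `c`. -/
abbrev Extension.part {c : T.Subtree} (c' : c.Extension) (e : c.Leaf) : T.Subtree :=
  c'.1.above e.1 (c'.edges_subset e.2.1)

/-- An extension of `c` amounts to a choice, for each leaf `e` of `c`, of a subtree with
root `e`. -/
def extensionEquiv (c : T.Subtree) : c.Extension ≃ ∀ e : c.Leaf, RootedAt e.1 where
  toFun c' e := ⟨c'.part e, rfl⟩
  invFun d := ⟨c.glue d, fun _ => Or.inl, rfl⟩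
  left_inv c' := by
    refine Subtype.ext (ext_nodes c'.2.2 ?_)
    ext n
    constructor
    · rintro (h | ⟨e, h⟩)
      · exact c'.2.1 h
      · exact h.2
    · intro h
      exact (c.mem_nodes_or_exists_leaf (c'.nodes_subset_ideal h)).imp_right
        fun ⟨e, he⟩ => ⟨e, he, h⟩
  right_inv d := by
    funext e
    have hsub : ∀ e, (d e).1.nodes ⊆ (ideal e.1).nodes := fun e =>
      (d e).1.nodes_subset_ideal_of_root_eq (d e).2
    refine Subtype.ext (ext_nodes (d e).2.symm ?_)
    ext n
    constructor
    -- No node of `c` lies above one of its leaves, and a node grafted at `e'` lies above `e` only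
    -- if `e = e'`.
    · rintro ⟨h, h' | ⟨e', h'⟩⟩
      · exact absurd h (c.notMem_ideal_leaf e h')
      · obtain rfl : e = e' := c.leaf_unique (a := T.out n) h (hsub e' h')
        exact h'
    · intro h
      exact ⟨hsub e h, Or.inr ⟨e, h⟩⟩

/-- The leaves of an extension `c'` of `c` are the leaves of the parts of `c'` above the leaves
of `c`. -/
noncomputable def leafSigmaEquiv {c : T.Subtree} (c' : c.Extension) :
    (Σ e : c.Leaf, (c'.part e).Leaf) ≃ c'.1.Leaf :=
  Equiv.ofBijective
    -- A node of `c'` whose output is an edge of the part at `e` belongs to that part, so a leaf of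
    -- the part is a leaf of `c'`.
    (fun x => ⟨x.2.1, x.2.2.1.2, fun n hn h =>
      x.2.2.2 n ⟨(h ▸ x.2.2.1.1 : T.out n ∈ (ideal x.1.1).edges), hn⟩ h⟩) (by
    constructor
    · rintro ⟨e, a, ha⟩ ⟨e', a', ha'⟩ h
      obtain rfl : a = a' := congrArg Subtype.val h
      obtain rfl := c.leaf_unique ha.1.1 ha'.1.1
      rfl
    · rintro ⟨a, ha, ha'⟩
      rcases c.exists_leaf (a := a) (by
        have := c'.1.mem_ideal_of_mem ha
        rwa [← c'.2.2] at this) with ⟨n, hn, h⟩ | ⟨e, he⟩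
      · exact absurd h (ha' n (c'.2.1 hn))
      · exact ⟨⟨e, a, ⟨he, ha⟩, fun n hn => ha' n hn.2⟩, rfl⟩)

/-- The nodes of an extension `c'` of `c` are the nodes of `c` and the nodes of the parts of `c'`
above the leaves of `c`. -/
noncomputable def nodeSigmaEquiv {c : T.Subtree} (c' : c.Extension) :
    (Σ e : c.Leaf, (c'.part e).nodes) ⊕ c.nodes ≃ c'.1.nodes :=
  Equiv.ofBijective
    (Sum.elim (fun x => ⟨x.2.1, x.2.2.2⟩) fun n => ⟨n.1, c'.2.1 n.2⟩) (by
    constructor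
    · rintro (⟨e, n, hn⟩ | ⟨n, hn⟩) (⟨e', n', hn'⟩ | ⟨n', hn'⟩) h
      · obtain rfl : n = n' := congrArg Subtype.val h
        obtain rfl := c.leaf_unique (a := T.out n) hn.1 hn'.1
        rfl
      · obtain rfl : n = n' := congrArg Subtype.val h
        exact absurd hn.1 (c.notMem_ideal_leaf e hn')
      · obtain rfl : n = n' := congrArg Subtype.val h
        exact absurd hn'.1 (c.notMem_ideal_leaf e' hn)
      · obtain rfl : n = n' := congrArg Subtype.val h
        rfl
    · rintro ⟨n, hn⟩
      rcases c.mem_nodes_or_exists_leaf (c'.nodes_subset_ideal hn) with h | ⟨e, h⟩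
      · exact ⟨Sum.inr ⟨n, h⟩, rfl⟩
      · exact ⟨Sum.inl ⟨e, n, h, hn⟩, rfl⟩)

/-- A subtree of a subtree, as a subtree of the ambient tree. -/
def image {S : T.Subtree} (S' : S.toTree.Subtree) : T.Subtree where
  edges := {a | ∃ h : a ∈ S.edges, (⟨a, h⟩ : S.edges) ∈ S'.edges}
  nodes := {n | ∃ h : n ∈ S.nodes, (⟨n, h⟩ : S.nodes) ∈ S'.nodes}
  root := S'.root.1
  root_mem := ⟨S'.root.2, S'.root_mem⟩
  out_mem := by
    rintro n ⟨hn, hn'⟩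
    exact ⟨_, S'.out_mem _ hn'⟩
  src_mem := by
    rintro m ⟨hm, hm'⟩
    exact ⟨_, S'.src_mem ⟨m, hm⟩ hm'⟩
  eq_root_iff := by
    rintro a ⟨ha, ha'⟩
    have h1 : a = S'.root.1 ↔ (⟨a, ha⟩ : S.edges) = S'.root :=
      ⟨fun h => Subtype.ext h, congrArg Subtype.val⟩
    refine h1.trans ((S'.eq_root_iff _ ha').trans (not_congr ⟨?_, ?_⟩))
    · rintro ⟨⟨m, hm⟩, hm', h⟩
      exact ⟨m, ⟨hm, hm'⟩, congrArg Subtype.val h⟩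
    · rintro ⟨m, ⟨hm, hm'⟩, h⟩
      exact ⟨⟨m, hm⟩, hm', Subtype.ext h⟩

/-- A subtree contained in `S`, as a subtree of the tree `S`. -/
def Restriction.comap {S : T.Subtree} (c : S.Restriction) : S.toTree.Subtree where
  edges := {a : S.edges | a.1 ∈ c.1.edges}
  nodes := {n : S.nodes | n.1 ∈ c.1.nodes}
  root := (⟨c.1.root, c.edges_subset c.1.root_mem⟩ : S.edges)
  root_mem := c.1.root_mem
  out_mem n hn := c.1.out_mem n.1 hn
  src_mem m hm := c.1.src_mem m.1 hm
  eq_root_iff := by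
    rintro ⟨a, ha⟩ ha'
    have h1 : a = c.1.root ↔
        (⟨a, ha⟩ : S.edges) = ⟨c.1.root, c.edges_subset c.1.root_mem⟩ :=
      ⟨fun h => Subtype.ext h, congrArg Subtype.val⟩
    refine h1.symm.trans ((c.1.eq_root_iff a ha').trans (not_congr ⟨?_, ?_⟩))
    · rintro ⟨m, hm, h⟩
      exact ⟨⟨m, c.2.1 hm⟩, hm, Subtype.ext h⟩
    · rintro ⟨⟨m, hm⟩, hm', h⟩
      exact ⟨m, hm', congrArg Subtype.val h⟩

/-- The cuts of a subtree `S` are the subtrees contained in `S` with the same root. -/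
def cutToTreeEquiv (S : T.Subtree) : S.toTree.Cut ≃ S.Restriction where
  toFun c := ⟨image c.1, fun _ h => h.1, congrArg Subtype.val (c.1.root_eq_of_mem c.2)⟩
  invFun c := ⟨c.comap, c.1.mem_of_root_eq c.2.2⟩
  left_inv c := by
    refine Subtype.ext (ext_nodes rfl ?_)
    ext n
    exact ⟨fun h => h.2, fun h => ⟨n.2, h⟩⟩
  right_inv c := by
    refine Subtype.ext (ext_nodes rfl ?_)
    ext n
    exact ⟨fun h => h.2, fun h => ⟨c.2.1 h, h⟩⟩

/-- The leaves of a subtree of a subtree. -/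
def leafImageEquiv {S : T.Subtree} (S' : S.toTree.Subtree) : S'.Leaf ≃ (image S').Leaf where
  toFun a := ⟨a.1.1, ⟨a.1.2, a.2.1⟩, fun _ hn h => a.2.2 _ hn.2 (Subtype.ext h)⟩
  invFun a := ⟨(⟨a.1, a.2.1.1⟩ : S.edges), a.2.1.2, fun n hn h =>
    a.2.2 n.1 ⟨n.2, hn⟩ (congrArg Subtype.val h)⟩
  left_inv _ := rfl
  right_inv _ := rfl

/-- The walks of `S` and of `T` agree except at the root of `S`, which the former fixes. -/
theorem mem_ideal_toTree_iff (S : T.Subtree) (a x : S.edges) :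
    a ∈ (ideal (T := S.toTree) x).edges ↔ a.1 ∈ (ideal x.1).edges := by
  constructor
  · rintro ⟨k, hk⟩
    induction k generalizing a with
    | zero =>
      obtain rfl : a = x := hk
      exact (ideal a.1).root_mem
    | succ k ih =>
      by_cases har : a = S.toTree.root
      · rw [har, iterate_walk_root] at hk
        obtain rfl : a = x := har.trans hk
        exact (ideal a.1).root_mem
      · obtain ⟨m, rfl⟩ := (exists_src_iff (T := S.toTree) a).2 har
        rw [Function.iterate_succ_apply, walk_src] at hk
        exact src_mem_ideal (ih _ hk)
  · rintro ⟨k, hk⟩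
    induction k generalizing a with
    | zero =>
      obtain rfl : a = x := Subtype.ext hk
      exact (ideal (T := S.toTree) a).root_mem
    | succ k ih =>
      by_cases har : a = S.toTree.root
      -- The walk in `T` may continue below the root `a` of `S`; but `x` also lies above `a`, so the
      -- two coincide.
      · have : a.1 = x.1 := mem_ideal_antisymm ⟨k + 1, hk⟩ (by
          rw [har]
          exact S.mem_ideal_of_mem x.2)
        obtain rfl : a = x := Subtype.ext this
        exact (ideal (T := S.toTree) a).root_mem
      · obtain ⟨m, rfl⟩ := (exists_src_iff (T := S.toTree) a).2 har
        refine src_mem_ideal (T := S.toTree) (ih _ ?_)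
        rw [← hk, Function.iterate_succ_apply]
        exact congrArg _ (walk_src m.1).symm

theorem image_ideal (S : T.Subtree) (x : S.edges) :
    image (ideal (T := S.toTree) x) = S.above x.1 x.2 := by
  refine ext_nodes rfl ?_
  ext n
  constructor
  · rintro ⟨h, h'⟩
    exact ⟨(S.mem_ideal_toTree_iff _ x).1 h', h⟩
  · rintro ⟨h', h⟩
    exact ⟨h, (S.mem_ideal_toTree_iff ⟨T.out n, S.out_mem n h⟩ x).2 h'⟩

end Subtree

end OperadicTree

/-! ### Nested pairs of subtrees and coassociativity. -/

namespace OperadicTree.Subtree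

variable {T : OperadicTree}

/-- The pairs of nested subtrees with root `r`, fibred over the smaller or over the larger one. -/
def nestedEquiv (r : T.Edge) :
    (Σ c : RootedAt r, c.1.Extension) ≃ Σ c' : RootedAt r, c'.1.Restriction where
  toFun x := ⟨⟨x.2.1, x.2.2.2.symm.trans x.1.2⟩, x.1.1, x.2.2⟩
  invFun x := ⟨⟨x.2.1, x.2.2.2.trans x.1.2⟩, x.1.1, x.2.2⟩
  left_inv _ := rfl
  right_inv _ := rfl

/-- The cuts of a tree are the subtrees with the same root. -/
def cutEquivRootedAt : T.Cut ≃ RootedAt T.root :=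
  Equiv.subtypeEquivRight fun S => S.root_mem_iff

/-- The subtrees with root `x` are those contained in the ideal subtree generated by `x`. -/
def restrictionIdealEquiv (x : T.Edge) : (ideal x).Restriction ≃ RootedAt x :=
  Equiv.subtypeEquivRight fun S =>
    ⟨fun h => h.2, fun h => ⟨S.nodes_subset_ideal_of_root_eq h, h⟩⟩

end OperadicTree.Subtree

section PTrees

variable {I : Type u₁} {E : Type u₂} {B : Type u₃}
  [Groupoid.{v₁} I] [Groupoid.{v₂} E] [Groupoid.{v₃} B] {P : FinitaryPolynomial I E B}

namespace PTree

open OperadicTree OperadicTree.Subtree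

/-- Restricting to a subtree of a subtree is restricting to its image. -/
def restrictRestrictIso (T : PTree P) (S : T.Subtree) (S' : S.toTree.Subtree) :
    Iso ((T.restrict S).restrict S') (T.restrict (image S')) where
  edge := Equiv.subtypeSubtypeEquivSubtypeExists (· ∈ S.edges) (· ∈ S'.edges)
  input := Equiv.subtypeSubtypeEquivSubtypeExists (fun m => T.node m ∈ S.nodes)
    (fun m => (⟨T.node m.1, m.2⟩ : S.nodes) ∈ S'.nodes)
  node := Equiv.subtypeSubtypeEquivSubtypeExists (· ∈ S.nodes) (· ∈ S'.nodes)
  src_comm h := by cases h; rfl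
  node_comm h := by cases h; rfl
  out_comm h := by cases h; rfl
  edgeArr h := eqToHom (congrArg T.edgeDec (congrArg Subtype.val h))
  inputArr h := eqToHom (congrArg T.inputDec (congrArg Subtype.val h))
  nodeArr h := eqToHom (congrArg T.nodeDec (congrArg Subtype.val h))
  src_sq h := by
    cases h
    exact (Category.comp_id _).trans
      ((congrArg (· ≫ _) (P.s.map_id _)).trans (Category.id_comp _)).symm
  node_sq h := by
    cases h
    exact (Category.comp_id _).trans
      ((congrArg (· ≫ _) (P.p.map_id _)).trans (Category.id_comp _)).symm
  out_sq h := by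
    cases h
    exact (Category.comp_id _).trans
      ((congrArg (· ≫ _) (P.t.map_id _)).trans (Category.id_comp _)).symm

/-- A tree is the ideal subtree generated by its root. -/
def restrictIdealRootIso (T : PTree P) : Iso (T.restrict (ideal T.root)) T where
  edge := Equiv.subtypeUnivEquiv mem_ideal_root
  input := Equiv.subtypeUnivEquiv fun m => mem_ideal_root (T.out (T.node m))
  node := Equiv.subtypeUnivEquiv fun n => mem_ideal_root (T.out n)
  src_comm h := by cases h; rfl
  node_comm h := by cases h; rfl
  out_comm h := by cases h; rfl
  edgeArr h := eqToHom (congrArg T.edgeDec h)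
  inputArr h := eqToHom (congrArg T.inputDec h)
  nodeArr h := eqToHom (congrArg T.nodeDec h)
  src_sq h := by
    cases h
    exact (Category.comp_id _).trans
      ((congrArg (· ≫ _) (P.s.map_id _)).trans (Category.id_comp _)).symm
  node_sq h := by
    cases h
    exact (Category.comp_id _).trans
      ((congrArg (· ≫ _) (P.p.map_id _)).trans (Category.id_comp _)).symm
  out_sq h := by
    cases h
    exact (Category.comp_id _).trans
      ((congrArg (· ≫ _) (P.t.map_id _)).trans (Category.id_comp _)).symm

end PTree

namespace TreeAlgebra

open OperadicTree OperadicTree.Subtree PTree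

theorem prod_tmul_prod {R A A' ι : Type*} [CommRing R] [CommRing A] [Algebra R A] [CommRing A']
    [Algebra R A'] (s : Finset ι) (f : ι → A) (g : ι → A') :
    (∏ i ∈ s, f i) ⊗ₜ[R] (∏ i ∈ s, g i) = ∏ i ∈ s, f i ⊗ₜ[R] g i := by
  classical
  induction s using Finset.induction_on with
  | empty => simp [Algebra.TensorProduct.one_def]
  | insert a s ha ih =>
    simp only [Finset.prod_insert ha, ← ih, Algebra.TensorProduct.tmul_mul_tmul]

theorem comul_gen (T : PTree P) : comul P (gen T) = comulTree T :=
  MvPolynomial.aeval_X _ _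

theorem counit_gen (T : PTree P) :
    counit P (gen T) = if nodeCount (cls T) = 0 then 1 else 0 :=
  MvPolynomial.aeval_X _ _

theorem gen_restrict_ideal_root (T : PTree P) : gen (T.restrict (ideal T.root)) = gen T :=
  gen_congr T.restrictIdealRootIso

/-- By `image_ideal`, what `S` has above a leaf of `S'` is cut out of `T` by `above`. This moves
cuts of the tree `S` back into `T`. -/
theorem crown_restrict (T : PTree P) (S : T.Subtree) (S' : S.toTree.Subtree)
    (h : ∀ e : (image S').Leaf, e.1 ∈ S.edges) :
    crown (T.restrict S) S' = ∏ e : (image S').Leaf, gen (T.restrict (S.above e.1 (h e))) := by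
  refine Fintype.prod_equiv (leafImageEquiv S') _ _ fun e => ?_
  refine (gen_congr (T.restrictRestrictIso S _)).trans ?_
  exact congrArg (fun S'' => gen (T.restrict S'')) (S.image_ideal e.1)

theorem comulTree_eq (T : PTree P) :
    comulTree T = ∑ c : RootedAt T.root, crown T c.1 ⊗ₜ[ℚ] gen (T.restrict c.1) :=
  Fintype.sum_equiv cutEquivRootedAt _ _ fun _ => rfl

theorem comulTree_restrict (T : PTree P) (S : T.Subtree) :
    comulTree (T.restrict S) = ∑ c : S.Restriction,
      (∏ e : c.1.Leaf, gen (T.restrict (S.above e.1 (c.edges_subset e.2.1)))) ⊗ₜ[ℚ]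
        gen (T.restrict c.1) := by
  refine Fintype.sum_equiv (cutToTreeEquiv S) _ _ fun c => ?_
  rw [crown_restrict T S c.1 fun e => e.2.1.1, gen_congr (T.restrictRestrictIso S c.1)]
  rfl

/-- Inside `D_x` the part above an edge is all of what `T` has above it, so the crowns are those of
`T`. -/
theorem comulTree_restrict_ideal (T : PTree P) (x : T.Edge) :
    comulTree (T.restrict (ideal x)) =
      ∑ d : RootedAt x, crown T d.1 ⊗ₜ[ℚ] gen (T.restrict d.1) := by
  rw [comulTree_restrict]
  refine Fintype.sum_equiv (restrictionIdealEquiv x) _ _ fun c => ?_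
  congr 1
  refine Finset.prod_congr rfl fun e _ => ?_
  rw [above_ideal]

theorem crown_extension (T : PTree P) {c : T.Subtree} (c' : c.Extension) :
    crown T c'.1 = ∏ e : c.Leaf, crown T (c'.part e) := by
  simp only [crown]
  rw [← Fintype.prod_sigma', ← (leafSigmaEquiv c').prod_comp]
  rfl

theorem comul_crown (T : PTree P) (c : T.Subtree) :
    comul P (crown T c) = ∑ c' : c.Extension,
      crown T c'.1 ⊗ₜ[ℚ] ∏ e : c.Leaf, gen (T.restrict (c'.part e)) := by
  classical
  rw [crown, map_prod]
  simp only [comul_gen, comulTree_restrict_ideal]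
  -- The product of sums expands over all choices of one cut per `D_e`, which `extensionEquiv` turns
  -- into extensions of `c`.
  rw [Finset.prod_univ_sum, Fintype.piFinset_univ]
  refine (Fintype.sum_equiv c.extensionEquiv _ _ fun c' => ?_).symm
  rw [crown_extension, prod_tmul_prod]
  rfl

theorem comul_coassoc_gen (T : PTree P) :
    Algebra.TensorProduct.assoc ℚ ℚ ℚ _ _ _
        (Algebra.TensorProduct.map (comul P) (.id ℚ _) (comul P (gen T))) =
      Algebra.TensorProduct.map (.id ℚ _) (comul P) (comul P (gen T)) := by
  rw [comul_gen, comulTree_eq]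
  simp only [comul_gen, map_sum, Algebra.TensorProduct.map_tmul, AlgHom.id_apply,
    comul_crown, comulTree_restrict, TensorProduct.sum_tmul, TensorProduct.tmul_sum,
    Algebra.TensorProduct.assoc_tmul]
  -- Both sides now run over nested pairs, fibred over the smaller subtree on the left and over the
  -- larger one on the right, with identical summands.
  refine (Fintype.sum_sigma' _).symm.trans (Eq.trans ?_ (Fintype.sum_sigma' _))
  exact Fintype.sum_equiv (nestedEquiv T.root) _ _ fun _ => rfl

end TreeAlgebra

end PTrees

/-! ### Counting along cuts and the counit laws. -/

namespace OperadicTree.Subtree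

variable {T : OperadicTree}

/-- The nodeless subtree with a single edge. -/
def single (x : T.Edge) : T.Subtree where
  edges := {x}
  nodes := ∅
  root := x
  root_mem := rfl
  out_mem _ h := h.elim
  src_mem _ h := h.elim
  eq_root_iff _ h := ⟨fun _ ⟨_, h, _⟩ => h, fun _ => h⟩

/-- The whole tree as an extension of a subtree containing the root. -/
def RootedAt.extension (c : RootedAt T.root) : c.1.Extension :=
  ⟨ideal T.root, fun n _ => mem_ideal_root (T.out n), c.2⟩

theorem RootedAt.part_extension (c : RootedAt T.root) (e : c.1.Leaf) :
    c.extension.part e = ideal e.1 :=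
  above_ideal _

/-- The leaves of a subtree regarded as a tree. -/
def isLeafToTreeEquiv (S : T.Subtree) : {a : S.edges // S.toTree.IsLeaf a} ≃ S.Leaf where
  toFun a := ⟨a.1.1, a.1.2, fun n hn h => a.2 ⟨n, hn⟩ (Subtype.ext h)⟩
  invFun a := ⟨⟨a.1, a.2.1⟩, fun n h => a.2.2 n.1 n.2 (congrArg Subtype.val h)⟩
  left_inv _ := rfl
  right_inv _ := rfl

theorem card_nodes (c : RootedAt T.root) :
    ∑ e : c.1.Leaf, Nat.card (ideal e.1).nodes + Nat.card c.1.nodes = Nat.card T.Node := by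
  have h := Nat.card_congr ((nodeSigmaEquiv c.extension).trans
    (Equiv.subtypeUnivEquiv fun n => mem_ideal_root (T.out n)))
  rw [Nat.card_sum, Nat.card_sigma] at h
  simpa only [c.part_extension] using h

end OperadicTree.Subtree

section PTrees

variable {I : Type u₁} {E : Type u₂} {B : Type u₃}
  [Groupoid.{v₁} I] [Groupoid.{v₂} E] [Groupoid.{v₃} B] {P : FinitaryPolynomial I E B}

namespace PTree

open OperadicTree OperadicTree.Subtree

theorem nodeCount_restrict (T : PTree P) (S : T.Subtree) :
    nodeCount (cls (T.restrict S)) = Nat.card S.nodes := rfl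

theorem leafCount_restrict (T : PTree P) (S : T.Subtree) :
    leafCount (cls (T.restrict S)) = Nat.card S.Leaf :=
  Nat.card_congr S.isLeafToTreeEquiv

theorem nodeCount_restrict_eq_zero_iff (T : PTree P) (S : T.Subtree) :
    nodeCount (cls (T.restrict S)) = 0 ↔ S.nodes = ∅ := by
  rw [nodeCount_restrict, Finite.card_eq_zero_iff, Set.isEmpty_coe_sort]

theorem sum_nodeCount (T : PTree P) (c : RootedAt T.root) :
    ∑ e : c.1.Leaf, nodeCount (cls (T.restrict (ideal e.1))) + nodeCount (cls (T.restrict c.1)) =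
      nodeCount (cls T) :=
  card_nodes c

/-- The whole tree is an extension of `c` with parts `D_e`, so each leaf of `T` lies above exactly
one leaf of `c`. -/
theorem sum_leafCount (T : PTree P) (c : RootedAt T.root) :
    ∑ e : c.1.Leaf, leafCount (cls (T.restrict (ideal e.1))) = leafCount (cls T) := by
  have h := Nat.card_congr (leafSigmaEquiv c.extension)
  rw [Nat.card_sigma] at h
  rw [← T.restrictIdealRootIso.cls_eq]
  simp only [leafCount_restrict]
  simp only [c.part_extension] at h
  exact h

/-- Every edge but the root is an input of some node. Hence nodeless trees, where the counit is
nonzero, have operadic degree zero. -/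
theorem leafCount_eq_one_of_nodeCount_eq_zero (x : Class P) (h : nodeCount x = 0) :
    leafCount x = 1 := by
  induction x using Quotient.inductionOn with | h T
  have : IsEmpty T.Node := Finite.card_eq_zero_iff.1 h
  have hr : ∀ a, a = T.root := fun a => by
    by_contra ha
    obtain ⟨m, -⟩ := (exists_src_iff a).2 ha
    exact isEmptyElim (T.node m)
  refine Nat.card_eq_one_iff_unique.2 ⟨⟨fun a b => ?_⟩, ⟨⟨T.root, fun n => isEmptyElim n⟩⟩⟩
  exact Subtype.ext ((hr a.1).trans (hr b.1).symm)

theorem IsDead.restrict_ideal {T : PTree P} (hT : T.IsDead) (x : T.Edge) :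
    (T.restrict (ideal x)).IsDead := by
  rintro ⟨a, ha⟩ h
  refine hT a fun n hn => ?_
  subst hn
  exact h ⟨n, ha⟩ rfl

end PTree

namespace TreeAlgebra

open OperadicTree OperadicTree.Subtree PTree

/-- A node missing from `c` lies above some leaf `e`, and then the factor of `D_e` vanishes. -/
theorem counit_crown (T : PTree P) (c : RootedAt T.root) [Decidable (c.1 = ideal T.root)] :
    counit P (crown T c.1) = if c.1 = ideal T.root then 1 else 0 := by
  rw [crown, map_prod]
  simp only [counit_gen, nodeCount_restrict_eq_zero_iff]
  split_ifs with h
  · refine Finset.prod_eq_one fun e _ => if_pos ?_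
    refine Set.eq_empty_of_forall_notMem fun n hn => c.1.notMem_ideal_leaf e ?_ hn
    rw [h]
    exact mem_ideal_root (T.out n)
  · obtain ⟨n, hn⟩ : ∃ n, n ∉ c.1.nodes := by
      by_contra! hc
      exact h (ext_nodes c.2 (Set.ext fun n => iff_of_true (hc n) (mem_ideal_root (T.out n))))
    rcases c.1.mem_nodes_or_exists_leaf (n := n)
      (by rw [c.2]; exact mem_ideal_root (T.out n)) with h' | ⟨e, he⟩
    · exact absurd h' hn
    · exact Finset.prod_eq_zero (Finset.mem_univ e)
        (if_neg fun h0 : (ideal e.1).nodes = ∅ => Set.notMem_empty n (h0 ▸ he))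

theorem counit_gen_restrict (T : PTree P) (c : RootedAt T.root)
    [Decidable (c.1 = single T.root)] :
    counit P (gen (T.restrict c.1)) = if c.1 = single T.root then 1 else 0 := by
  rw [counit_gen]
  refine if_congr ?_ rfl rfl
  rw [nodeCount_restrict_eq_zero_iff]
  exact ⟨fun h => ext_nodes c.2 h, fun h => by rw [h]; rfl⟩

theorem crown_single_root (T : PTree P) : crown T (single T.root) = gen T := by
  let e₀ : (single T.root).Leaf := ⟨T.root, rfl, fun _ h => h.elim⟩
  have h : ∀ e : (single T.root).Leaf, e = e₀ := fun e => Subtype.ext e.2.1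
  rw [crown, Fintype.prod_eq_single e₀ fun e he => absurd (h e) he]
  exact gen_restrict_ideal_root T

theorem counit_left_gen (T : PTree P) :
    Algebra.TensorProduct.map (counit P) (.id ℚ _) (comul P (gen T)) = 1 ⊗ₜ[ℚ] gen T := by
  classical
  rw [comul_gen, comulTree_eq]
  simp only [map_sum, Algebra.TensorProduct.map_tmul, AlgHom.id_apply, counit_crown]
  rw [Fintype.sum_eq_single (⟨ideal T.root, rfl⟩ : RootedAt T.root)]
  · rw [if_pos rfl, gen_restrict_ideal_root]
  · intro c hc
    rw [if_neg fun h => hc (Subtype.ext h), TensorProduct.zero_tmul]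

theorem counit_right_gen (T : PTree P) :
    Algebra.TensorProduct.map (.id ℚ _) (counit P) (comul P (gen T)) = gen T ⊗ₜ[ℚ] 1 := by
  classical
  rw [comul_gen, comulTree_eq]
  simp only [map_sum, Algebra.TensorProduct.map_tmul, AlgHom.id_apply, counit_gen_restrict]
  rw [Fintype.sum_eq_single (⟨single T.root, rfl⟩ : RootedAt T.root)]
  · rw [if_pos rfl, crown_single_root]
  · intro c hc
    rw [if_neg fun h => hc (Subtype.ext h), TensorProduct.tmul_zero]

theorem algHom_ext {A : Type*} [CommSemiring A] [Algebra ℚ A] {f g : TreeAlgebra P →ₐ[ℚ] A}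
    (h : ∀ T : PTree P, f (gen T) = g (gen T)) : f = g :=
  MvPolynomial.algHom_ext fun x => Quotient.inductionOn x h

theorem isBialgebra (P : FinitaryPolynomial I E B) : IsBialgebra (comul P) (counit P) where
  coassoc := algHom_ext comul_coassoc_gen
  counit_left := algHom_ext counit_left_gen
  counit_right := algHom_ext counit_right_gen

end TreeAlgebra

end PTrees

/-! ### General facts on gradings, polynomial algebras and coideal subalgebras. -/

section Grading

variable {R H M : Type*} [CommRing R] [CommRing H] [Algebra R H] [CommRing M] [Algebra R M]
  {ι : Type*}

theorem tensorGrading_eq_span [AddMonoid ι] (𝒜 : ι → Submodule R M) (ℬ : ι → Submodule R H)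
    (n : ι) : tensorGrading 𝒜 ℬ n =
      Submodule.span R {z | ∃ i j, i + j = n ∧ ∃ a ∈ 𝒜 i, ∃ b ∈ ℬ j, a ⊗ₜ[R] b = z} := by
  apply le_antisymm
  · refine iSup_le ?_
    rintro ⟨⟨i, j⟩, h⟩ _ ⟨y, rfl⟩
    induction y with
    | zero => rw [map_zero]; exact Submodule.zero_mem _
    | add x y hx hy => rw [map_add]; exact Submodule.add_mem _ hx hy
    | tmul a b => exact Submodule.subset_span ⟨i, j, h, a, a.2, b, b.2, rfl⟩
  · rw [Submodule.span_le]
    rintro _ ⟨i, j, h, a, ha, b, hb, rfl⟩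
    exact Submodule.mem_iSup_of_mem ⟨(i, j), h⟩ ⟨⟨a, ha⟩ ⊗ₜ ⟨b, hb⟩, rfl⟩

theorem tmul_mem_tensorGrading [AddMonoid ι] {𝒜 : ι → Submodule R M} {ℬ : ι → Submodule R H}
    {i j n : ι} (h : i + j = n) {a : M} (ha : a ∈ 𝒜 i) {b : H} (hb : b ∈ ℬ j) :
    a ⊗ₜ[R] b ∈ tensorGrading 𝒜 ℬ n := by
  rw [tensorGrading_eq_span]
  exact Submodule.subset_span ⟨i, j, h, a, ha, b, hb, rfl⟩

/-- This lets homogeneity of an algebra map into a tensor product be checked on variables; no direct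
sum decomposition is needed. -/
instance tensorGrading_gradedMonoid [AddCommMonoid ι] (𝒜 : ι → Submodule R M)
    (ℬ : ι → Submodule R H) [SetLike.GradedMonoid 𝒜] [SetLike.GradedMonoid ℬ] :
    SetLike.GradedMonoid (tensorGrading 𝒜 ℬ) where
  one_mem := show (1 : M) ⊗ₜ[R] (1 : H) ∈ _ from
    tmul_mem_tensorGrading (add_zero 0) (SetLike.GradedOne.one_mem (A := 𝒜))
    (SetLike.GradedOne.one_mem (A := ℬ))
  mul_mem := by
    intro m n x y hx hy
    rw [tensorGrading_eq_span] at hx hy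
    have := Submodule.mul_mem_mul hx hy
    rw [Submodule.span_mul_span] at this
    refine Submodule.span_le.2 ?_ this
    rintro _ ⟨_, ⟨i, j, rfl, a, ha, b, hb, rfl⟩, _, ⟨i', j', rfl, a', ha', b', hb', rfl⟩, rfl⟩
    change (a ⊗ₜ[R] b) * (a' ⊗ₜ[R] b') ∈ tensorGrading 𝒜 ℬ _
    rw [Algebra.TensorProduct.tmul_mul_tmul]
    refine tmul_mem_tensorGrading (add_add_add_comm i i' j j') ?_ ?_
    · exact SetLike.mul_mem_graded ha ha'
    · exact SetLike.mul_mem_graded hb hb'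

instance inducedGrading_gradedMonoid [AddMonoid ι] (ℬ : ι → Submodule R H)
    [SetLike.GradedMonoid ℬ] (D : Subalgebra R H) :
    SetLike.GradedMonoid (inducedGrading ℬ D) where
  one_mem := SetLike.GradedOne.one_mem (A := ℬ)
  mul_mem _ _ _ _ hx hy := SetLike.mul_mem_graded (A := ℬ) hx hy

/-- A subalgebra generated by homogeneous elements is graded. -/
theorem nonempty_gradedAlgebra_inducedGrading [DecidableEq ι] [AddMonoid ι]
    (ℬ : ι → Submodule R H) [GradedAlgebra ℬ] {s : Set H}
    (hs : ∀ x ∈ s, SetLike.IsHomogeneousElem ℬ x) {D : Subalgebra R H}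
    (hD : Algebra.adjoin R s = D) : Nonempty (GradedAlgebra (inducedGrading ℬ D)) := by
  subst hD
  -- Independence is inherited from `ℬ` through the inclusion.
  have hind : iSupIndep (inducedGrading ℬ (Algebra.adjoin R s)) := fun i => by
    rw [Submodule.disjoint_def]
    intro x hx hx'
    have hle : (⨆ j, ⨆ (_ : j ≠ i), inducedGrading ℬ (Algebra.adjoin R s) j) ≤
        (⨆ j, ⨆ (_ : j ≠ i), ℬ j).comap (Algebra.adjoin R s).val.toLinearMap :=
      iSup₂_le fun j hj => Submodule.comap_mono (le_iSup₂ (f := fun j (_ : j ≠ i) => ℬ j) j hj)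
    have h := (DirectSum.Decomposition.isInternal ℬ).submodule_iSupIndep i
    exact Subtype.ext (Submodule.disjoint_def.1 h x.1 hx (hle hx'))
  -- The sum of the pieces is closed under products and contains the scalars and the generators, so
  -- it is everything.
  have hsup : iSup (inducedGrading ℬ (Algebra.adjoin R s)) = ⊤ := by
    have hmul : iSup (inducedGrading ℬ (Algebra.adjoin R s)) * iSup (inducedGrading ℬ (Algebra.adjoin R s)) ≤
        iSup (inducedGrading ℬ (Algebra.adjoin R s)) := by
      rw [Submodule.iSup_mul]
      refine iSup_le fun i => ?_
      rw [Submodule.mul_iSup]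
      refine iSup_le fun j => Submodule.mul_le.2 fun x hx y hy => ?_
      exact Submodule.mem_iSup_of_mem (i + j) (SetLike.mul_mem_graded hx hy)
    rw [eq_top_iff]
    rintro ⟨x, hx⟩ -
    induction hx using Algebra.adjoin_induction with
    | mem x hx =>
      obtain ⟨i, hi⟩ := hs x hx
      exact Submodule.mem_iSup_of_mem i hi
    | algebraMap r =>
      refine Submodule.mem_iSup_of_mem 0 ?_
      exact SetLike.algebraMap_mem_graded ℬ r
    | add x y hx hy h h' => exact Submodule.add_mem _ h h'
    | mul x y hx hy h h' => exact hmul (Submodule.mul_mem_mul h h')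
  exact ⟨{ toDecomposition := ((DirectSum.isInternal_submodule_iff_iSupIndep_and_iSup_eq_top _).2
      ⟨hind, hsup⟩).chooseDecomposition }⟩

/-- An algebra homomorphism from a polynomial algebra preserves degrees if it does so on the
variables. -/
theorem MvPolynomial.algHom_mem_of_X_mem {σ A : Type*} [CommRing A] [Algebra R A]
    [AddCommMonoid ι] (w : σ → ι) (𝒯 : ι → Submodule R A) [SetLike.GradedMonoid 𝒯]
    (ψ : MvPolynomial σ R →ₐ[R] A) (h : ∀ i, ψ (X i) ∈ 𝒯 (w i)) {n : ι} {p : MvPolynomial σ R}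
    (hp : p ∈ weightedHomogeneousSubmodule R w n) : ψ p ∈ 𝒯 n := by
  rw [p.as_sum, map_sum]
  refine Submodule.sum_mem _ fun d hd => ?_
  have hd' : Finsupp.weight w d = n := hp (mem_support_iff.1 hd)
  rw [monomial_eq, map_mul, ← algebraMap_eq, ψ.commutes, ← Algebra.smul_def, Finsupp.prod,
    map_prod, ← hd', Finsupp.weight_apply]
  simp only [map_pow]
  exact Submodule.smul_mem _ _ (SetLike.prod_pow_mem_graded _ _ _ _ fun i _ => h i)

/-- A monomial of nonzero weight contains a variable of nonzero weight, which `ψ` kills. -/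
theorem MvPolynomial.algHom_eq_zero_of_weight_ne_zero {σ : Type*} [AddCommMonoid ι] (w : σ → ι)
    (ψ : MvPolynomial σ R →ₐ[R] R) (h : ∀ i, w i ≠ 0 → ψ (X i) = 0) {n : ι} (hn : n ≠ 0)
    {p : MvPolynomial σ R} (hp : p ∈ weightedHomogeneousSubmodule R w n) : ψ p = 0 := by
  rw [p.as_sum, map_sum]
  refine Finset.sum_eq_zero fun d hd => ?_
  have hd' : Finsupp.weight w d = n := hp (mem_support_iff.1 hd)
  obtain ⟨i, hi, hwi⟩ : ∃ i ∈ d.support, w i ≠ 0 := by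
    by_contra! hc
    refine hn (hd'.symm.trans ?_)
    rw [Finsupp.weight_apply]
    exact Finset.sum_eq_zero fun i hi => by simp only [hc i hi, smul_zero]
  rw [monomial_eq, map_mul, Finsupp.prod, map_prod, Finset.prod_eq_zero hi, mul_zero]
  rw [map_pow, h i hwi, zero_pow (Finsupp.mem_support_iff.1 hi)]

/-- If the comultiplication restricts to a homomorphism `ρ : D → D ⊗ H`, then `ρ` is a coaction. -/
theorem IsBialgebra.isRightCoidealAlgebra {Δ : H →ₐ[R] H ⊗[R] H} {ε : H →ₐ[R] R}
    (hH : IsBialgebra Δ ε) [Module.Flat R H] [Module.Flat R (H ⊗[R] H)] (D : Subalgebra R H)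
    (ρ : D →ₐ[R] D ⊗[R] H)
    (h : (Algebra.TensorProduct.map D.val (.id R H)).comp ρ = Δ.comp D.val) :
    IsRightCoidealAlgebra Δ ε D ρ where
  restrict := h
  coassoc := by
    -- By flatness the identity may be tested after embedding `D` in `H`, where it becomes
    -- coassociativity of `Δ`.
    have hinj : Function.Injective (Algebra.TensorProduct.map D.val (.id R (H ⊗[R] H))) :=
      Module.Flat.rTensor_preserves_injective_linearMap (M := H ⊗[R] H) D.val.toLinearMap
        Subtype.val_injective
    rw [← AlgHom.cancel_left hinj]
    have h1 : (Algebra.TensorProduct.map D.val (.id R (H ⊗[R] H))).comp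
        ((Algebra.TensorProduct.assoc R R R D H H).toAlgHom.comp
          (Algebra.TensorProduct.map ρ (.id R H))) =
        ((Algebra.TensorProduct.assoc R R R H H H).toAlgHom.comp
          (Algebra.TensorProduct.map Δ (.id R H))).comp
            (Algebra.TensorProduct.map D.val (.id R H)) := by
      have h3 : (Algebra.TensorProduct.map D.val (.id R (H ⊗[R] H))).comp
          (Algebra.TensorProduct.assoc R R R D H H).toAlgHom =
          (Algebra.TensorProduct.assoc R R R H H H).toAlgHom.comp
            (Algebra.TensorProduct.map (Algebra.TensorProduct.map D.val (.id R H)) (.id R H)) := by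
        ext <;> simp [Algebra.TensorProduct.one_def]
      rw [← AlgHom.comp_assoc, h3, AlgHom.comp_assoc, AlgHom.comp_assoc,
        ← Algebra.TensorProduct.map_comp, ← Algebra.TensorProduct.map_comp, h]
    have h2 : (Algebra.TensorProduct.map D.val (.id R (H ⊗[R] H))).comp
        (Algebra.TensorProduct.map (.id R D) Δ) =
        (Algebra.TensorProduct.map (.id R H) Δ).comp
          (Algebra.TensorProduct.map D.val (.id R H)) := by
      ext <;> simp
    calc _ = ((Algebra.TensorProduct.map D.val (.id R (H ⊗[R] H))).comp
        ((Algebra.TensorProduct.assoc R R R D H H).toAlgHom.comp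
          (Algebra.TensorProduct.map ρ (.id R H)))).comp ρ := rfl
      _ = ((Algebra.TensorProduct.assoc R R R H H H).toAlgHom.comp
          ((Algebra.TensorProduct.map Δ (.id R H)).comp Δ)).comp D.val := by
        rw [h1, AlgHom.comp_assoc, h]; rfl
      _ = ((Algebra.TensorProduct.map (.id R H) Δ).comp
          (Algebra.TensorProduct.map D.val (.id R H))).comp ρ := by
        rw [hH.coassoc, AlgHom.comp_assoc, AlgHom.comp_assoc, h]
      _ = _ := by rw [← h2]; rfl
  counit := by
    have hinj : Function.Injective (Algebra.TensorProduct.map D.val (.id R R)) :=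
      Module.Flat.rTensor_preserves_injective_linearMap (M := R) D.val.toLinearMap
        Subtype.val_injective
    rw [← AlgHom.cancel_left hinj]
    have h2 : (Algebra.TensorProduct.map D.val (.id R R)).comp
        (Algebra.TensorProduct.map (.id R D) ε) =
        (Algebra.TensorProduct.map (.id R H) ε).comp
          (Algebra.TensorProduct.map D.val (.id R H)) := by
      ext <;> simp
    rw [← AlgHom.comp_assoc, h2, AlgHom.comp_assoc, h, ← AlgHom.comp_assoc, hH.counit_right]
    ext x
    simp

end Grading

/-! ### The two gradings of `B_P` and the coaction on dead trees. -/

section PTrees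

variable {I : Type u₁} {E : Type u₂} {B : Type u₃}
  [Groupoid.{v₁} I] [Groupoid.{v₂} E] [Groupoid.{v₃} B] {P : FinitaryPolynomial I E B}

namespace TreeAlgebra

open OperadicTree OperadicTree.Subtree PTree

section Weight

variable {ι : Type*} [AddCommMonoid ι]

/-- A weight of trees is additive along cuts if the weight of each tree is the total weight of the
pieces into which a cut decomposes it. -/
def IsAdditiveAlongCuts (w : Class P → ι) : Prop :=
  ∀ (T : PTree P) (c : RootedAt T.root),
    ∑ e : c.1.Leaf, w (cls (T.restrict (ideal e.1))) + w (cls (T.restrict c.1)) = w (cls T)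

theorem gen_mem (w : Class P → ι) (T : PTree P) :
    gen T ∈ MvPolynomial.weightedHomogeneousSubmodule ℚ w (w (cls T)) :=
  MvPolynomial.isWeightedHomogeneous_X ℚ w (cls T)

instance (w : Class P → ι) :
    SetLike.GradedMonoid (MvPolynomial.weightedHomogeneousSubmodule ℚ w) :=
  MvPolynomial.WeightedHomogeneousSubmodule.gradedMonoid

theorem crown_mem (w : Class P → ι) (T : PTree P) (S : T.Subtree) :
    crown T S ∈ MvPolynomial.weightedHomogeneousSubmodule ℚ w
      (∑ e : S.Leaf, w (cls (T.restrict (ideal e.1)))) :=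
  SetLike.prod_mem_graded _ _ _ fun e _ => gen_mem w (T.restrict (ideal e.1))

theorem comulTree_mem {w : Class P → ι} (hw : IsAdditiveAlongCuts w) (T : PTree P) :
    comulTree T ∈ tensorGrading (MvPolynomial.weightedHomogeneousSubmodule ℚ w)
      (MvPolynomial.weightedHomogeneousSubmodule ℚ w) (w (cls T)) := by
  rw [comulTree_eq]
  exact Submodule.sum_mem _ fun c _ =>
    tmul_mem_tensorGrading (hw T c) (crown_mem w T c.1) (gen_mem w _)

/-- Additivity along cuts makes `comul` homogeneous; `hw0` makes `counit` so, as it is nonzero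
exactly on the nodeless trees. -/
theorem isBialgebraGrading [DecidableEq ι] {w : Class P → ι} (hw : IsAdditiveAlongCuts w)
    (hw0 : ∀ x, nodeCount x = 0 → w x = 0) :
    IsBialgebraGrading (comul P) (counit P) (MvPolynomial.weightedHomogeneousSubmodule ℚ w) where
  graded := ⟨MvPolynomial.weightedGradedAlgebra ℚ w⟩
  comul_mem n x hx := by
    refine MvPolynomial.algHom_mem_of_X_mem w _ (comul P) (fun y => ?_) hx
    induction y using Quotient.inductionOn with | h T
    have := comulTree_mem hw T
    rwa [← comul_gen] at this
  counit_eq_zero n hn x hx := by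
    refine MvPolynomial.algHom_eq_zero_of_weight_ne_zero w (counit P) (fun y hy => ?_) hn hx
    exact (MvPolynomial.aeval_X _ _).trans (if_neg fun h => hy (hw0 y h))

end Weight

theorem crown_mem_dead {T : PTree P} (hT : T.IsDead) (S : T.Subtree) : crown T S ∈ dead P :=
  Subalgebra.prod_mem _ fun e _ => Algebra.subset_adjoin ⟨_, hT.restrict_ideal e.1, rfl⟩

/-- The coaction of a single dead tree. -/
noncomputable def coactTree (T : PTree P) (hT : T.IsDead) : dead P ⊗[ℚ] TreeAlgebra P :=
  ∑ c : RootedAt T.root,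
    (⟨crown T c.1, crown_mem_dead hT c.1⟩ : dead P) ⊗ₜ[ℚ] gen (T.restrict c.1)

theorem map_coactTree (T : PTree P) (hT : T.IsDead) :
    Algebra.TensorProduct.map (dead P).val (.id ℚ (TreeAlgebra P)) (coactTree T hT) =
      comulTree T := by
  rw [coactTree, map_sum, comulTree_eq]
  rfl

theorem coactTree_mem {ι : Type*} [AddCommMonoid ι] {w : Class P → ι}
    (hw : IsAdditiveAlongCuts w) (T : PTree P) (hT : T.IsDead) :
    coactTree T hT ∈ tensorGrading
      (inducedGrading (MvPolynomial.weightedHomogeneousSubmodule ℚ w) (dead P))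
      (MvPolynomial.weightedHomogeneousSubmodule ℚ w) (w (cls T)) :=
  Submodule.sum_mem _ fun c _ =>
    tmul_mem_tensorGrading (𝒜 := inducedGrading _ (dead P)) (hw T c)
      (show crown T c.1 ∈ _ from crown_mem w T c.1) (gen_mem w _)

open Classical in
/-- The algebra homomorphism on `B_P` which extends the coaction of the dead trees and vanishes on
the trees which are not dead. -/
noncomputable def coactExtension (P : FinitaryPolynomial I E B) :
    TreeAlgebra P →ₐ[ℚ] dead P ⊗[ℚ] TreeAlgebra P :=
  MvPolynomial.aeval fun x =>
    -- The choice of dead representative is harmless: in `B_P ⊗ B_P` the value becomes `comulTree`,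
    -- which depends only on the class. The value `0` elsewhere lies in every degree.
    if h : ∃ T : PTree P, T.IsDead ∧ cls T = x then coactTree h.choose h.choose_spec.1 else 0

theorem coactExtension_gen {T : PTree P} (hT : T.IsDead) :
    ∃ (T' : PTree P) (hT' : T'.IsDead), gen T' = gen T ∧
      coactExtension P (gen T) = coactTree T' hT' := by
  have h : ∃ T' : PTree P, T'.IsDead ∧ cls T' = cls T := ⟨T, hT, rfl⟩
  exact ⟨h.choose, h.choose_spec.1, congrArg MvPolynomial.X h.choose_spec.2,
    (MvPolynomial.aeval_X _ _).trans (dif_pos h)⟩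

theorem coactExtension_mem {ι : Type*} [AddCommMonoid ι] {w : Class P → ι}
    (hw : IsAdditiveAlongCuts w) (x : Class P) :
    coactExtension P (MvPolynomial.X x) ∈ tensorGrading
      (inducedGrading (MvPolynomial.weightedHomogeneousSubmodule ℚ w) (dead P))
      (MvPolynomial.weightedHomogeneousSubmodule ℚ w) (w x) := by
  rw [coactExtension, MvPolynomial.aeval_X]
  split_ifs with h
  · have := coactTree_mem hw h.choose h.choose_spec.1
    exact (congrArg w h.choose_spec.2) ▸ this
  · exact Submodule.zero_mem _

/-- The coaction of `B_P` on the subalgebra generated by the dead trees. -/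
noncomputable def coact (P : FinitaryPolynomial I E B) :
    dead P →ₐ[ℚ] dead P ⊗[ℚ] TreeAlgebra P :=
  (coactExtension P).comp (dead P).val

theorem map_comp_coact (P : FinitaryPolynomial I E B) :
    (Algebra.TensorProduct.map (dead P).val (.id ℚ (TreeAlgebra P))).comp (coact P) =
      (comul P).comp (dead P).val := by
  refine AlgHom.adjoin_ext ?_
  rintro _ ⟨T, hT, rfl⟩
  -- The chosen representative `T'` may differ from `T`, but both give the same generator.
  obtain ⟨T', hT', hgen, h⟩ := coactExtension_gen hT
  calc _ = Algebra.TensorProduct.map (dead P).val (.id ℚ (TreeAlgebra P))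
        (coactExtension P (gen T)) := rfl
    _ = comul P (gen T) := by rw [h, map_coactTree, ← comul_gen, hgen]

theorem isComoduleAlgebraGrading {ι : Type*} [AddCommMonoid ι] [DecidableEq ι] {w : Class P → ι}
    (hw : IsAdditiveAlongCuts w) :
    IsComoduleAlgebraGrading (coact P) (MvPolynomial.weightedHomogeneousSubmodule ℚ w)
      (inducedGrading (MvPolynomial.weightedHomogeneousSubmodule ℚ w) (dead P)) where
  graded := by
    let := MvPolynomial.weightedGradedAlgebra ℚ w
    refine nonempty_gradedAlgebra_inducedGrading (MvPolynomial.weightedHomogeneousSubmodule ℚ w)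
      (s := {x | ∃ T : PTree P, T.IsDead ∧ gen T = x}) ?_ rfl
    rintro _ ⟨T, -, rfl⟩
    exact ⟨w (cls T), gen_mem w T⟩
  coaction_mem n x hx := by
    have hx' : x.1 ∈ MvPolynomial.weightedHomogeneousSubmodule ℚ w n := hx
    exact MvPolynomial.algHom_mem_of_X_mem w
      (tensorGrading (inducedGrading (MvPolynomial.weightedHomogeneousSubmodule ℚ w) (dead P))
        (MvPolynomial.weightedHomogeneousSubmodule ℚ w))
      (coactExtension P) (coactExtension_mem hw) hx'

theorem isAdditiveAlongCuts_nodeCount :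
    IsAdditiveAlongCuts (fun x : Class P => nodeCount x) := sum_nodeCount

theorem isAdditiveAlongCuts_leafCount :
    IsAdditiveAlongCuts (fun x : Class P => (leafCount x : ℤ) - 1) := by
  intro T c
  have h := sum_leafCount T c
  dsimp only
  -- The terms `-1`, one for each leaf of `c`, cancel the leaf count of `c`, leaving only the `-1`
  -- for its root.
  rw [← h, leafCount_restrict T c.1, Nat.card_eq_fintype_card]
  simp

end TreeAlgebra

end PTrees

theorem mainTheorem8 {I : Type u₁} {E : Type u₂} {B : Type u₃}
    [Groupoid.{v₁} I] [Groupoid.{v₂} E] [Groupoid.{v₃} B] (P : FinitaryPolynomial I E B) :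
    IsBialgebra (TreeAlgebra.comul P) (TreeAlgebra.counit P) ∧
    IsBialgebraGrading (TreeAlgebra.comul P) (TreeAlgebra.counit P) (TreeAlgebra.nodeGrading P) ∧
    IsBialgebraGrading (TreeAlgebra.comul P) (TreeAlgebra.counit P)
      (TreeAlgebra.operadicGrading P) ∧
    ∃ ρ : TreeAlgebra.dead P →ₐ[ℚ] TreeAlgebra.dead P ⊗[ℚ] TreeAlgebra P,
      IsRightCoidealAlgebra (TreeAlgebra.comul P) (TreeAlgebra.counit P) (TreeAlgebra.dead P) ρ ∧
      IsComoduleAlgebraGrading ρ (TreeAlgebra.nodeGrading P)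
        (inducedGrading (TreeAlgebra.nodeGrading P) (TreeAlgebra.dead P)) ∧
      IsComoduleAlgebraGrading ρ (TreeAlgebra.operadicGrading P)
        (inducedGrading (TreeAlgebra.operadicGrading P) (TreeAlgebra.dead P)) := by
  have hP := TreeAlgebra.isBialgebra P
  refine ⟨hP, TreeAlgebra.isBialgebraGrading TreeAlgebra.isAdditiveAlongCuts_nodeCount fun _ h => h,
    TreeAlgebra.isBialgebraGrading TreeAlgebra.isAdditiveAlongCuts_leafCount fun x h => ?_,
    TreeAlgebra.coact P, hP.isRightCoidealAlgebra _ _ (TreeAlgebra.map_comp_coact P),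
    TreeAlgebra.isComoduleAlgebraGrading TreeAlgebra.isAdditiveAlongCuts_nodeCount,
    TreeAlgebra.isComoduleAlgebraGrading TreeAlgebra.isAdditiveAlongCuts_leafCount⟩
  rw [PTree.leafCount_eq_one_of_nodeCount_eq_zero x h, Nat.cast_one, sub_self]
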